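/- All Hilbert spaces are complex and finite-dimensional. A (bipartite) strategy $S=(|\psi\rangle,\{E_{xa}\},\{F_{yb}\})$ consists of a unit vector $|\psi\rangle\in\mathcal H_A\otimes\mathcal H_B$, a POVM $\{E_{xa}\}_{a\in\mathcal O_A}$ on $\mathcal H_A$ for every input $x\in\mathcal I_A$ of Alice (that is, $E_{xa}\ge 0$ and $\sum_a E_{xa}=\mathrm{Id}$), and a POVM $\{F_{yb}\}_{b\in\mathcal O_B}$ on $\mathcal H_B$ for every input $y\in\mathcal I_B$ of Bob, where $\mathcal I_A,\mathcal O_A,\mathcal I_B,\mathcal O_B$ are finite sets. It is irreducible if the $E_{xa}$ generate $L(\mathcal H_A)$ and the $F_{yb}$ generate $L(\mathcal H_B)$ as complex (unital) algebras. Orthonormal bases $(u_i)$ of $\mathcal H_A$ and $(v_j)$ of $\mathcal H_B$ give a matrix representation of $S$: matrices for the $E_{xa}$ and $F_{yb}$, and a coordinate vector for $|\psi\rangle$ with respect to $(u_i\otimes v_j)$; complex conjugates $\overline{\,\cdot\,}$ below are taken entrywise in it. The pair of bases is a Schmidt basis if $|\psi\rangle=\sum_{k\le\min(\dim\mathcal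 H_A,\dim\mathcal H_B)}\lambda_k\,u_k\otimes v_k$ with real $\lambda_k\ge 0$. Consider the following properties of $S$: 1. Schmidt real: in some Schmidt basis, the matrix representation of $S$ is real; 2. real: in some pair of orthonormal bases, the matrix representation of $S$ is real; 3. Schmidt self-conjugate: for some Schmidt basis there are unitary matrices $U_A,U_B$ with $U_AE_{xa}U_A^*=\overline{E_{xa}}$, $U_BF_{yb}U_B^*=\overline{F_{yb}}$ and $(U_A\otimes U_B)|\psi\rangle=|\overline\psi\rangle$ for all $x,a,y,b$; 3'. the same for every Schmidt basis; 4. self-conjugate: for some pair of orthonormal bases there are such unitaries; 4'. the same for every pair of orthonormal bases; 5. moment-real: $\langle\psi|E\otimes F|\psi\rangle\in\mathbb R$ for all words (finite products, the empty product being $\mathrm{Id}$) $E$ in the $E_{xa}$ and $F$ in the $F_{yb}$. Theorem. Let $S$ be an irreducible strategy. Then $$(1)\Leftrightarrow(2)\Rightarrow(3)\Leftrightarrow(3')\Leftrightarrow(4)\Leftrightarrow(4')\Leftrightarrow(5).$$ If moreover each of the two parties satisfies at least one of the following conditions, - its local dimension is $2$ or odd; - its local dimension is $4$ or $6$, it has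 at most three inputs, and its measurements are binary (two outputs) and projective (every measurement operator is idempotent), (not necessarily the same one), then all of (1), (2), (3), (3'), (4), (4'), (5) are equivalent. -/

import Mathlib

open scoped TensorProduct Kronecker

noncomputable section

/-- A (bipartite, finite-dimensional) quantum strategy: a unit vector in `HA ⊗ HB` shared by
Alice and Bob, a POVM `(E x a)ₐ` on `HA` for every input `x` of Alice, and a POVM `(F y b)_b` on
`HB` for every input `y` of Bob. -/
structure BipartiteStrategy (IA OA IB OB HA HB : Type*) [Fintype OA] [Fintype OB]
    [NormedAddCommGroup HA] [InnerProductSpace ℂ HA] [FiniteDimensional ℂ HA]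
    [NormedAddCommGroup HB] [InnerProductSpace ℂ HB] [FiniteDimensional ℂ HB] where
  /-- the shared pure state -/
  state : HA ⊗[ℂ] HB
  norm_state : ‖state‖ = 1
  /-- Alice's measurement operators -/
  E : IA → OA → Module.End ℂ HA
  E_pos : ∀ x a, (E x a).IsPositive
  E_sum : ∀ x, ∑ a, E x a = 1
  /-- Bob's measurement operators -/
  F : IB → OB → Module.End ℂ HB
  F_pos : ∀ y b, (F y b).IsPositive
  F_sum : ∀ y, ∑ b, F y b = 1

/-- The word (product of measurement operators) `E x₁ a₁ * ⋯ * E xₖ aₖ`;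
the empty word is the identity. -/
def measurementWord {I O H : Type*} [AddCommGroup H] [Module ℂ H]
    (E : I → O → Module.End ℂ H) (w : List (I × O)) : Module.End ℂ H :=
  (w.map fun p => E p.1 p.2).prod

/-- The measurement operators generate all linear operators as a complex (unital) algebra. -/
def GeneratesAllOperators {I O H : Type*} [AddCommGroup H] [Module ℂ H]
    (E : I → O → Module.End ℂ H) : Prop :=
  Algebra.adjoin ℂ {T | ∃ x a, T = E x a} = ⊤

/-- The condition imposed on one party: the local dimension is `2` or odd; or it is `4` or `6`,
there are at most three inputs, and the measurements are binary and projective. -/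
def SmallSide {I O H : Type*} [Fintype I] [Fintype O] [AddCommGroup H] [Module ℂ H]
    (E : I → O → Module.End ℂ H) : Prop :=
  (Module.finrank ℂ H = 2 ∨ Odd (Module.finrank ℂ H)) ∨
    ((Module.finrank ℂ H = 4 ∨ Module.finrank ℂ H = 6) ∧ Fintype.card I ≤ 3 ∧
      Fintype.card O = 2 ∧ ∀ x a, E x a * E x a = E x a)

/-- Orthonormal bases of a finite-dimensional Hilbert space, indexed by `0, …, dim H - 1`. -/
abbrev ONBasis (H : Type*) [NormedAddCommGroup H] [InnerProductSpace ℂ H] : Type _ :=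
  OrthonormalBasis (Fin (Module.finrank ℂ H)) ℂ H

namespace BipartiteStrategy

variable {IA OA IB OB HA HB : Type*} [Fintype OA] [Fintype OB]
  [NormedAddCommGroup HA] [InnerProductSpace ℂ HA] [FiniteDimensional ℂ HA]
  [NormedAddCommGroup HB] [InnerProductSpace ℂ HB] [FiniteDimensional ℂ HB]

/-- A strategy is irreducible if the operators of each party generate all operators on that
party's space. -/
def IsIrreducible (S : BipartiteStrategy IA OA IB OB HA HB) : Prop :=
  GeneratesAllOperators S.E ∧ GeneratesAllOperators S.F

/-- The matrix of Alice's operator `E x a` in the orthonormal basis `u` of `HA`. -/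
def matE (S : BipartiteStrategy IA OA IB OB HA HB) (u : ONBasis HA) (x : IA) (a : OA) :
    Matrix (Fin (Module.finrank ℂ HA)) (Fin (Module.finrank ℂ HA)) ℂ :=
  LinearMap.toMatrixOrthonormal u (S.E x a)

/-- The matrix of Bob's operator `F y b` in the orthonormal basis `v` of `HB`. -/
def matF (S : BipartiteStrategy IA OA IB OB HA HB) (v : ONBasis HB) (y : IB) (b : OB) :
    Matrix (Fin (Module.finrank ℂ HB)) (Fin (Module.finrank ℂ HB)) ℂ :=
  LinearMap.toMatrixOrthonormal v (S.F y b)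

/-- The coordinates of the state in the product basis `u i ⊗ v j`. -/
def coord (S : BipartiteStrategy IA OA IB OB HA HB) (u : ONBasis HA) (v : ONBasis HB) :
    Fin (Module.finrank ℂ HA) × Fin (Module.finrank ℂ HB) → ℂ :=
  fun p => (u.tensorProduct v).repr S.state p

/-- `(u, v)` is a Schmidt basis for the state:
`ψ = ∑ k < min (dim HA) (dim HB), lam k • (u k ⊗ v k)` with real coefficients `lam k ≥ 0`. -/
def IsSchmidtBasis (S : BipartiteStrategy IA OA IB OB HA HB)
    (u : ONBasis HA) (v : ONBasis HB) : Prop :=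
  ∃ lam : Fin (min (Module.finrank ℂ HA) (Module.finrank ℂ HB)) → ℝ, (∀ k, 0 ≤ lam k) ∧
    S.state = ∑ k, (lam k : ℂ) •
      (u (Fin.castLE (min_le_left _ _) k) ⊗ₜ[ℂ] v (Fin.castLE (min_le_right _ _) k))

/-- The matrix representation of the strategy in the bases `u`, `v` is real. -/
def RealIn (S : BipartiteStrategy IA OA IB OB HA HB) (u : ONBasis HA) (v : ONBasis HB) : Prop :=
  (∀ x a i j, (S.matE u x a i j).im = 0) ∧ (∀ y b i j, (S.matF v y b i j).im = 0) ∧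
    ∀ p, (S.coord u v p).im = 0

/-- In the bases `u`, `v`, the strategy is carried to its entrywise complex conjugate by
local unitaries. -/
def SelfConjugateIn (S : BipartiteStrategy IA OA IB OB HA HB)
    (u : ONBasis HA) (v : ONBasis HB) : Prop :=
  ∃ UA ∈ Matrix.unitaryGroup (Fin (Module.finrank ℂ HA)) ℂ,
  ∃ UB ∈ Matrix.unitaryGroup (Fin (Module.finrank ℂ HB)) ℂ,
    (∀ x a, UA * S.matE u x a * UA.conjTranspose = (S.matE u x a).map star) ∧
    (∀ y b, UB * S.matF v y b * UB.conjTranspose = (S.matF v y b).map star) ∧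
    (UA ⊗ₖ UB).mulVec (S.coord u v) = star (S.coord u v)

/-- Some Schmidt matrix representation is real. -/
def IsSchmidtReal (S : BipartiteStrategy IA OA IB OB HA HB) : Prop :=
  ∃ u v, S.IsSchmidtBasis u v ∧ S.RealIn u v

/-- Some matrix representation is real. -/
def IsReal (S : BipartiteStrategy IA OA IB OB HA HB) : Prop :=
  ∃ u v, S.RealIn u v

/-- Self-conjugate in some Schmidt basis. -/
def IsSchmidtSelfConjugate (S : BipartiteStrategy IA OA IB OB HA HB) : Prop :=
  ∃ u v, S.IsSchmidtBasis u v ∧ S.SelfConjugateIn u v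

/-- Self-conjugate in every Schmidt basis. -/
def IsSchmidtSelfConjugateAll (S : BipartiteStrategy IA OA IB OB HA HB) : Prop :=
  ∀ u v, S.IsSchmidtBasis u v → S.SelfConjugateIn u v

/-- Self-conjugate in some pair of orthonormal bases. -/
def IsSelfConjugate (S : BipartiteStrategy IA OA IB OB HA HB) : Prop :=
  ∃ u v, S.SelfConjugateIn u v

/-- Self-conjugate in every pair of orthonormal bases. -/
def IsSelfConjugateAll (S : BipartiteStrategy IA OA IB OB HA HB) : Prop :=
  ∀ u v, S.SelfConjugateIn u v

/-- All moments `⟨ψ, (E-word ⊗ F-word) ψ⟩` are real. -/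
def IsMomentReal (S : BipartiteStrategy IA OA IB OB HA HB) : Prop :=
  ∀ (w : List (IA × OA)) (w' : List (IB × OB)),
    (inner ℂ S.state
      (TensorProduct.map (measurementWord S.E w) (measurementWord S.F w') S.state)).im = 0

end BipartiteStrategy

end

/-! In orthonormal bases the state becomes a matrix `M`, moments become `tr (Mᴴ E M Fᵀ)`, and local
unitaries act by `M ↦ U M Vᵀ`. If all moments are real, the strategy and its entrywise conjugate
have equal moments. By `Matrix.exists_unitaries_of_moments_eq`, moments determine an irreducible
strategy up to local unitaries: the pairs of corresponding operators generate the graph of a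
`⋆`-automorphism of a matrix algebra, which is inner, and the state is then fixed up to a phase.
Conversely, moments are invariant under local unitaries. Schmidt bases come from the singular value
decomposition; over the reals it uses orthogonal matrices, so it turns a real representation into a
Schmidt real one.

It remains to pass from self-conjugate to real for small sides. A unitary `U` implementing
conjugation on generators satisfies `Uᵀ = ±U`, because `Ū U` is central. If `Uᵀ = U`, then `x ↦ conj
(U x)` is an antiunitary involution; in an orthonormal basis of fixed vectors the operators, and
with them the state, are real. If `Uᵀ = -U`, this map is a quaternionic structure `J`, with `J² =
-1`, commuting with all measurement operators, and `SmallSide.not_quaternionic` excludes it. Indeed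
the dimension is then even; in dimension 2 the operators would be scalars; in dimension 4 or 6 each
binary projective measurement has a projection of rank at most 2, and three such projections share a
nonzero invariant subspace of dimension at most 3, contradicting irreducibility. -/

/-! ### Quaternionic structures and small invariant subspaces. -/

section Antilinear

variable {H : Type*} [NormedAddCommGroup H] [InnerProductSpace ℂ H]

/-- A finite-dimensional complex space with an antilinear map of square `-1` has even dimension. -/
theorem even_finrank_of_antilinear_sq_eq_neg {V : Type*} [AddCommGroup V] [Module ℂ V]
    [FiniteDimensional ℂ V] (J : V →ₛₗ[starRingEnd ℂ] V) (hJ : ∀ x, J (J x) = -x) :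
    Even (Module.finrank ℂ V) := by
  set b := Module.finBasis ℂ V
  set N : Matrix (Fin (Module.finrank ℂ V)) (Fin (Module.finrank ℂ V)) ℂ :=
    Matrix.of fun i j => b.repr (J (b j)) i with hN
  -- In coordinates `J` is `x ↦ N x̄`, so `J² = -1` reads `N N̄ = -1`; determinants give `|det N|² =
  -- (-1) ^ dim`.
  have hmul : N * N.map (starRingEnd ℂ) = -1 := by
    ext k i
    have h1 : J (b i) = ∑ j, N j i • b j := (b.sum_repr (J (b i))).symm
    have h2 : J (J (b i)) = ∑ j, (starRingEnd ℂ) (N j i) • J (b j) := by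
      conv_lhs => rw [h1]
      simp [map_sum, LinearMap.map_smulₛₗ]
    have h3 := congrArg (fun x => b.repr x k) h2
    rw [hJ] at h3
    simp only [map_neg, Module.Basis.repr_self, map_sum, map_smul, Finsupp.coe_neg, Pi.neg_apply,
      Finsupp.coe_finsetSum, Finset.sum_apply, Finsupp.coe_smul, Pi.smul_apply, smul_eq_mul] at h3
    rw [Matrix.mul_apply, Matrix.neg_apply, Matrix.one_apply]
    simp only [Finsupp.single_apply] at h3
    rw [show (if k = i then (1 : ℂ) else 0) = if i = k then 1 else 0 by simp [eq_comm], h3]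
    exact Finset.sum_congr rfl fun j _ => mul_comm _ _
  have hdet := congrArg Matrix.det hmul
  rw [Matrix.det_mul, Matrix.det_neg, Matrix.det_one, mul_one, Fintype.card_fin,
    show (N.map (starRingEnd ℂ)).det = (starRingEnd ℂ) N.det from
      ((starRingEnd ℂ).map_det N).symm, Complex.mul_conj] at hdet
  by_contra hodd
  rw [Nat.not_even_iff_odd] at hodd
  rw [hodd.neg_one_pow] at hdet
  have h : Complex.normSq N.det = -1 := by exact_mod_cast hdet
  linarith [Complex.normSq_nonneg N.det]

theorem even_finrank_range_of_commute_antilinear [FiniteDimensional ℂ H]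
    (J : H →ₛₗ[starRingEnd ℂ] H)
    (hJ : ∀ x, J (J x) = -x) {P : Module.End ℂ H} (hPJ : ∀ x, P (J x) = J (P x)) :
    Even (Module.finrank ℂ (LinearMap.range P)) := by
  refine even_finrank_of_antilinear_sq_eq_neg
    (V := LinearMap.range P)
    { toFun := fun x => ⟨J x, by
        obtain ⟨y, hy⟩ := x.2
        exact ⟨J y, by rw [hPJ, hy]⟩⟩
      map_add' := fun x y => Subtype.ext (by simp)
      map_smul' := fun c x => Subtype.ext (by simp [LinearMap.map_smulₛₗ]) } ?_
  intro x
  exact Subtype.ext (hJ x)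

/-- If `J x = a x`, then `J² x = |a|² x`, which cannot be `-x`. -/
theorem linearIndependent_pair_antilinear (J : H →ₛₗ[starRingEnd ℂ] H)
    (hJ : ∀ x, J (J x) = -x) {x : H} (hx : x ≠ 0) : LinearIndependent ℂ ![x, J x] := by
  rw [LinearIndependent.pair_iff' hx]
  intro a ha
  have h1 : J (J x) = ((starRingEnd ℂ) a * a) • x := by
    rw [← ha, LinearMap.map_smulₛₗ, ← ha, smul_smul]
  rw [hJ, eq_comm, ← sub_eq_zero, sub_neg_eq_add] at h1
  nth_rewrite 2 [← one_smul ℂ x] at h1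
  rw [← add_smul] at h1
  rcases smul_eq_zero.mp h1 with h | h
  · rw [mul_comm, Complex.mul_conj] at h
    have : Complex.normSq a + 1 = 0 := by exact_mod_cast h
    linarith [Complex.normSq_nonneg a]
  · exact hx h

/-- Compressing an operator that commutes with a quaternionic structure to a quaternionic line
gives a scalar. -/
theorem exists_compression_eq_smul [FiniteDimensional ℂ H]
    (J : H →ₛₗ[starRingEnd ℂ] H) (hJ : ∀ x, J (J x) = -x)
    {P T : Module.End ℂ H} (hP : P.IsSymmetric) (hPP : P * P = P)
    (hPJ : ∀ x, P (J x) = J (P x)) (hrank : Module.finrank ℂ (LinearMap.range P) ≤ 2)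
    (hT : T.IsSymmetric) (hTJ : ∀ x, T (J x) = J (T x)) :
    ∃ r : ℝ, P * T * P = (r : ℂ) • P := by
  by_cases hP0 : P = 0
  · exact ⟨0, by simp [hP0]⟩
  have hPx : ∀ x, P (P x) = P x := fun x => by
    rw [← Module.End.mul_apply, hPP]
  set S : Module.End ℂ H := P * T * P with hS
  have hSx : ∀ x, S x = P (T (P x)) := fun x => rfl
  have hSsym : S.IsSymmetric := fun x y => by
    rw [hSx, hSx, hP, hT, hP]
  have hSV : ∀ x ∈ LinearMap.range P, S x ∈ LinearMap.range P := fun x _ => ⟨T (P x), rfl⟩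
  have : Nontrivial (LinearMap.range P) := by
    rw [Submodule.nontrivial_iff_ne_bot]
    simpa [LinearMap.range_eq_bot] using hP0
  -- The eigenvalue is real by symmetry, so `J x` is an eigenvector for the same `μ`; by the rank
  -- bound `x` and `J x` span the range of `P`.
  obtain ⟨μ, hμ⟩ := Module.End.exists_eigenvalue (S.restrict hSV)
  obtain ⟨⟨x, hxV⟩, hx⟩ := hμ.exists_hasEigenvector
  have hx0 : x ≠ 0 := fun h => hx.2 (Subtype.ext h)
  have hSxμ : S x = μ • x := congrArg Subtype.val hx.apply_eq_smul
  have hSμ : Module.End.HasEigenvalue S μ :=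
    Module.End.hasEigenvalue_of_hasEigenvector
      (Module.End.hasEigenvector_iff.mpr ⟨Module.End.mem_eigenspace_iff.mpr hSxμ, hx0⟩)
  have hreal : (starRingEnd ℂ) μ = μ := hSsym.conj_eigenvalue_eq_self hSμ
  have hJV : J x ∈ LinearMap.range P := by
    obtain ⟨y, rfl⟩ := hxV
    exact ⟨J y, hPJ y⟩
  have hSJ : S (J x) = μ • J x := by
    have h : S (J x) = J (S x) := by rw [hSx, hSx, hPJ, hTJ, hPJ]
    rw [h, hSxμ, LinearMap.map_smulₛₗ, hreal]
  have hspan : Submodule.span ℂ (Set.range ![x, J x]) = LinearMap.range P := by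
    apply Submodule.eq_of_le_of_finrank_le
    · rw [Submodule.span_le]
      rintro _ ⟨i, rfl⟩
      fin_cases i
      · exact hxV
      · exact hJV
    · rw [finrank_span_eq_card (linearIndependent_pair_antilinear J hJ hx0)]
      simpa using hrank
  have hall : ∀ y ∈ LinearMap.range P, S y = μ • y := by
    intro y hy
    rw [← hspan] at hy
    induction hy using Submodule.span_induction with
    | mem y hy =>
      obtain ⟨i, rfl⟩ := hy
      fin_cases i
      · exact hSxμ
      · exact hSJ
    | zero => simp
    | add y z _ _ h1 h2 => rw [map_add, h1, h2, smul_add]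
    | smul a y _ h => rw [map_smul, h, smul_comm]
  refine ⟨μ.re, ?_⟩
  rw [Complex.conj_eq_iff_re.mp hreal]
  ext y
  have h := hall (P y) ⟨y, rfl⟩
  rw [hSx, hPx] at h
  exact h

theorem mul_eq_zero_of_symmetric {A B : Module.End ℂ H} (hA : A.IsSymmetric) (hB : B.IsSymmetric)
    (h : A * B = 0) : B * A = 0 := by
  ext x
  refine ext_inner_right ℂ fun y => ?_
  rw [Module.End.mul_apply, hB, hA, ← Module.End.mul_apply, h]
  simp

/-- `‖B A x‖² = ⟨x, A B A x⟩` for a symmetric projection `B`. -/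
theorem mul_eq_zero_of_mul_mul_eq_zero {A B : Module.End ℂ H} (hA : A.IsSymmetric)
    (hB : B.IsSymmetric) (hBB : B * B = B) (h : A * B * A = 0) : B * A = 0 := by
  ext x
  have hx : A (B (A x)) = 0 := LinearMap.congr_fun h x
  have hBBx : B (B (A x)) = B (A x) := by rw [← Module.End.mul_apply, hBB]
  have : inner ℂ (B (A x)) (B (A x)) = 0 := by
    rw [hB, hBBx, hA, hx, inner_zero_right]
  simpa using this

/-- A nonzero subspace of dimension at most three, invariant under a set of operators. -/
def HasSmallInvariantSubspace (s : Set (Module.End ℂ H)) : Prop :=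
  ∃ W : Submodule ℂ H, W ≠ ⊥ ∧ Module.finrank ℂ W ≤ 3 ∧ ∀ T ∈ s, ∀ x ∈ W, T x ∈ W

theorem hasSmallInvariantSubspace_of_span {s : Set (Module.End ℂ H)} (w : Fin 3 → H)
    (h0 : w 0 ≠ 0) (h : ∀ T ∈ s, ∀ k, T (w k) ∈ Submodule.span ℂ (Set.range w)) :
    HasSmallInvariantSubspace s := by
  refine ⟨Submodule.span ℂ (Set.range w), ?_, ?_, ?_⟩
  · intro hb
    exact h0 ((Submodule.mem_bot ℂ).mp (hb ▸ Submodule.subset_span ⟨0, rfl⟩))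
  · exact (finrank_range_le_card (R := ℂ) w).trans (by simp)
  · intro T hT x hx
    induction hx using Submodule.span_induction with
    | mem y hy =>
      obtain ⟨i, rfl⟩ := hy
      exact h T hT i
    | zero => simp
    | add y z _ _ h1 h2 => rw [map_add]; exact add_mem h1 h2
    | smul a y _ h => rw [map_smul]; exact Submodule.smul_mem _ _ h

/-- The degenerate case of orthogonal ranges: for any nonzero `w` in the range of `A`, the vectors
`w`, `C w`, `B C w` span an invariant subspace. -/
theorem hasSmallInvariantSubspace_of_mul_eq_zero {A B C : Module.End ℂ H}
    (hA : A.IsSymmetric) (hB : B.IsSymmetric)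
    (hAA : A * A = A) (hBB : B * B = B) (hCC : C * C = C) (hA0 : A ≠ 0) (hBA : B * A = 0)
    {r s : ℂ} (hACA : A * C * A = r • A) (hCBC : C * B * C = s • C) :
    HasSmallInvariantSubspace {A, B, C} := by
  obtain ⟨y, hy⟩ : ∃ y, A y ≠ 0 := by
    by_contra! h
    exact hA0 (LinearMap.ext h)
  set w := A y with hw
  have hAw : A w = w := by rw [hw, ← Module.End.mul_apply, hAA]
  have hBw : B w = 0 := by rw [hw, ← Module.End.mul_apply, hBA]; rfl
  have hAB : ∀ z, A (B z) = 0 := fun z =>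
    LinearMap.congr_fun (mul_eq_zero_of_symmetric hB hA hBA) z
  have hBBz : ∀ z, B (B z) = B z := fun z => LinearMap.congr_fun hBB z
  have hCCz : ∀ z, C (C z) = C z := fun z => LinearMap.congr_fun hCC z
  have hACw : A (C w) = r • w := by
    have := LinearMap.congr_fun hACA w
    simpa [Module.End.mul_apply, hAw] using this
  have hCBw : C (B (C w)) = s • C w := by
    simpa [Module.End.mul_apply] using LinearMap.congr_fun hCBC w
  set v : Fin 3 → H := ![w, C w, B (C w)] with hv
  have m0 : w ∈ Submodule.span ℂ (Set.range v) := Submodule.subset_span ⟨0, rfl⟩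
  have m1 : C w ∈ Submodule.span ℂ (Set.range v) := Submodule.subset_span ⟨1, rfl⟩
  have m2 : B (C w) ∈ Submodule.span ℂ (Set.range v) := Submodule.subset_span ⟨2, rfl⟩
  refine hasSmallInvariantSubspace_of_span v hy ?_
  intro T hT k
  rcases hT with rfl | rfl | rfl <;> fin_cases k <;>
    simp only [hv, Fin.zero_eta, Fin.mk_one, Fin.reduceFinMk, Matrix.cons_val_zero,
      Matrix.cons_val_one, Matrix.cons_val, hAw, hACw, hAB, hBw, hBBz, hCCz, hCBw] <;>
    first
    | exact zero_mem _
    | assumption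
    | exact Submodule.smul_mem _ _ ‹_›

/-- The generic case: for an eigenvector `w` of `A B C A` in the range of `A`, the span of `w`, `B
w`, `C w` is invariant. The scalar compression `hs` makes `w` an eigenvector of `A C B A` too, and
the relation `B A B = b' B` with `b' ≠ 0` recovers `B C w` from `A B C w` as a multiple of `B w`;
likewise for `C B w`. -/
theorem hasSmallInvariantSubspace_of_mul_ne_zero [FiniteDimensional ℂ H]
    {A B C : Module.End ℂ H}
    (hA : A.IsSymmetric) (hB : B.IsSymmetric) (hC : C.IsSymmetric)
    (hAA : A * A = A) (hBB : B * B = B) (hCC : C * C = C)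
    (hBA : B * A ≠ 0) (hCA : C * A ≠ 0)
    {b c b' c' s : ℂ} (hABA : A * B * A = b • A) (hACA : A * C * A = c • A)
    (hBAB : B * A * B = b' • B) (hCAC : C * A * C = c' • C)
    (hs : A * (B * C + C * B) * A = s • A) :
    HasSmallInvariantSubspace {A, B, C} := by
  have hA0 : A ≠ 0 := by rintro rfl; simp at hBA
  have hAx : ∀ x, A (A x) = A x := fun x => LinearMap.congr_fun hAA x
  have hBx : ∀ x, B (B x) = B x := fun x => LinearMap.congr_fun hBB x
  have hCx : ∀ x, C (C x) = C x := fun x => LinearMap.congr_fun hCC x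
  have hb' : b' ≠ 0 := fun h => by
    rw [h, zero_smul] at hBAB
    exact hBA (mul_eq_zero_of_symmetric hA hB (mul_eq_zero_of_mul_mul_eq_zero hB hA hAA hBAB))
  have hc' : c' ≠ 0 := fun h => by
    rw [h, zero_smul] at hCAC
    exact hCA (mul_eq_zero_of_symmetric hA hC (mul_eq_zero_of_mul_mul_eq_zero hC hA hAA hCAC))
  set S : Module.End ℂ H := A * B * C * A with hS
  have hSx : ∀ x, S x = A (B (C (A x))) := fun _ => rfl
  have hSV : ∀ x ∈ LinearMap.range A, S x ∈ LinearMap.range A := fun x _ => ⟨_, rfl⟩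
  have : Nontrivial (LinearMap.range A) := by
    rw [Submodule.nontrivial_iff_ne_bot]
    simpa [LinearMap.range_eq_bot] using hA0
  obtain ⟨μ, hμ⟩ := Module.End.exists_eigenvalue (S.restrict hSV)
  obtain ⟨⟨w, hwV⟩, hw⟩ := hμ.exists_hasEigenvector
  have hw0 : w ≠ 0 := fun h => hw.2 (Subtype.ext h)
  have hSw : S w = μ • w := congrArg Subtype.val hw.apply_eq_smul
  have hAw : A w = w := by
    obtain ⟨y, rfl⟩ := hwV
    exact hAx y
  have hABC : A (B (C w)) = μ • w := by rw [← hSw, hSx, hAw]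
  have hACB : A (C (B w)) = (s - μ) • w := by
    have h := LinearMap.congr_fun hs w
    simp only [Module.End.mul_apply, LinearMap.add_apply, map_add, hAw, LinearMap.smul_apply,
      hABC] at h
    rw [sub_smul, ← h, add_sub_cancel_left]
  have hABw : A (B w) = b • w := by
    simpa [Module.End.mul_apply, hAw] using LinearMap.congr_fun hABA w
  have hACw : A (C w) = c • w := by
    simpa [Module.End.mul_apply, hAw] using LinearMap.congr_fun hACA w
  have hBC : B (C w) = (b'⁻¹ * μ) • B w := by
    have h : b' • B (C w) = μ • B w := by
      rw [← map_smul B μ, ← hABC]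
      exact (LinearMap.congr_fun hBAB (C w)).symm
    rw [mul_smul, ← h, smul_smul, inv_mul_cancel₀ hb', one_smul]
  have hCB : C (B w) = (c'⁻¹ * (s - μ)) • C w := by
    have h : c' • C (B w) = (s - μ) • C w := by
      rw [← map_smul C (s - μ), ← hACB]
      exact (LinearMap.congr_fun hCAC (B w)).symm
    rw [mul_smul, ← h, smul_smul, inv_mul_cancel₀ hc', one_smul]
  set v : Fin 3 → H := ![w, B w, C w] with hv
  have m0 : w ∈ Submodule.span ℂ (Set.range v) := Submodule.subset_span ⟨0, rfl⟩
  have m1 : B w ∈ Submodule.span ℂ (Set.range v) := Submodule.subset_span ⟨1, rfl⟩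
  have m2 : C w ∈ Submodule.span ℂ (Set.range v) := Submodule.subset_span ⟨2, rfl⟩
  refine hasSmallInvariantSubspace_of_span v hw0 ?_
  intro T hT k
  rcases hT with rfl | rfl | rfl <;> fin_cases k <;>
    simp only [hv, Fin.zero_eta, Fin.mk_one, Fin.reduceFinMk, Matrix.cons_val_zero,
      Matrix.cons_val_one, Matrix.cons_val, hAw, hACw, hABw, hBx, hCx, hBC, hCB] <;>
    first
    | assumption
    | exact Submodule.smul_mem _ _ ‹_›

theorem hasSmallInvariantSubspace_triple_of_ne_zero [FiniteDimensional ℂ H]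
    (J : H →ₛₗ[starRingEnd ℂ] H) (hJ : ∀ x, J (J x) = -x) {A B C : Module.End ℂ H}
    (hA : A.IsSymmetricProjection) (hB : B.IsSymmetricProjection)
    (hC : C.IsSymmetricProjection)
    (hAJ : ∀ x, A (J x) = J (A x)) (hBJ : ∀ x, B (J x) = J (B x)) (hCJ : ∀ x, C (J x) = J (C x))
    (hAr : Module.finrank ℂ (LinearMap.range A) ≤ 2)
    (hBr : Module.finrank ℂ (LinearMap.range B) ≤ 2)
    (hCr : Module.finrank ℂ (LinearMap.range C) ≤ 2) (hA0 : A ≠ 0) :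
    HasSmallInvariantSubspace {A, B, C} := by
  obtain ⟨hAA, hAs⟩ := hA
  obtain ⟨hBB, hBs⟩ := hB
  obtain ⟨hCC, hCs⟩ := hC
  obtain ⟨b, hb⟩ := exists_compression_eq_smul J hJ hAs hAA hAJ hAr hBs hBJ
  obtain ⟨c, hc⟩ := exists_compression_eq_smul J hJ hAs hAA hAJ hAr hCs hCJ
  obtain ⟨b', hb'⟩ := exists_compression_eq_smul J hJ hBs hBB hBJ hBr hAs hAJ
  obtain ⟨c', hc'⟩ := exists_compression_eq_smul J hJ hCs hCC hCJ hCr hAs hAJ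
  obtain ⟨d, hd⟩ := exists_compression_eq_smul J hJ hBs hBB hBJ hBr hCs hCJ
  obtain ⟨d', hd'⟩ := exists_compression_eq_smul J hJ hCs hCC hCJ hCr hBs hBJ
  by_cases hBA : B * A = 0
  · exact hasSmallInvariantSubspace_of_mul_eq_zero hAs hBs hAA hBB hCC hA0 hBA hc hd'
  by_cases hCA : C * A = 0
  · rw [Set.pair_comm]
    exact hasSmallInvariantSubspace_of_mul_eq_zero hAs hCs hAA hCC hBB hA0 hCA hb hd
  -- `B C` alone need not be symmetric, so its compression need not be scalar; the anticommutator is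
  -- symmetric.
  have hsym : (B * C + C * B).IsSymmetric := fun x y => by
    simp only [LinearMap.add_apply, Module.End.mul_apply, inner_add_left, inner_add_right]
    rw [hBs, hCs, hCs, hBs, add_comm]
  obtain ⟨s, hs⟩ := exists_compression_eq_smul J hJ hAs hAA hAJ hAr hsym
    (fun x => by simp [hBJ, hCJ])
  exact hasSmallInvariantSubspace_of_mul_ne_zero hAs hBs hCs hAA hBB hCC hBA hCA hb hc hb' hc' hs

/-- Three quaternionic lines have a common small invariant subspace. -/
theorem hasSmallInvariantSubspace_range [FiniteDimensional ℂ H] [Nontrivial H]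
    (J : H →ₛₗ[starRingEnd ℂ] H) (hJ : ∀ x, J (J x) = -x) (P : Fin 3 → Module.End ℂ H)
    (hP : ∀ i, (P i).IsSymmetricProjection) (hPJ : ∀ i x, P i (J x) = J (P i x))
    (hPr : ∀ i, Module.finrank ℂ (LinearMap.range (P i)) ≤ 2) :
    HasSmallInvariantSubspace (Set.range P) := by
  have hr : ∀ i j k : Fin 3, (∀ l, l = i ∨ l = j ∨ l = k) → Set.range P ⊆ {P i, P j, P k} := by
    rintro i j k h _ ⟨l, rfl⟩
    rcases h l with rfl | rfl | rfl <;> simp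
  have key : ∀ i j k : Fin 3, (∀ l, l = i ∨ l = j ∨ l = k) → P i ≠ 0 →
      HasSmallInvariantSubspace (Set.range P) := by
    intro i j k h h0
    obtain ⟨W, h1, h2, h3⟩ := hasSmallInvariantSubspace_triple_of_ne_zero J hJ (hP i) (hP j) (hP k)
      (hPJ i) (hPJ j) (hPJ k) (hPr i) (hPr j) (hPr k) h0
    exact ⟨W, h1, h2, fun T hT => h3 T (hr i j k h hT)⟩
  by_cases h0 : P 0 = 0
  · by_cases h1 : P 1 = 0
    · by_cases h2 : P 2 = 0
      · obtain ⟨w, hw⟩ := exists_ne (0 : H)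
        refine hasSmallInvariantSubspace_of_span (fun _ => w) hw ?_
        rintro _ ⟨i, rfl⟩ k
        have : P i = 0 := by fin_cases i <;> assumption
        simp [this]
      · exact key 2 0 1 (by decide) h2
    · exact key 1 0 2 (by decide) h1
  · exact key 0 1 2 (by decide) h0

/-- Invariance passes to the generated algebra, hence to the rank-one operators carrying a nonzero
`w ∈ W` to an arbitrary vector. -/
theorem GeneratesAllOperators.eq_top_of_invariant {I O : Type*} {E : I → O → Module.End ℂ H}
    (hE : GeneratesAllOperators E) {W : Submodule ℂ H} (hW : W ≠ ⊥)
    (hinv : ∀ i o, ∀ x ∈ W, E i o x ∈ W) : W = ⊤ := by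
  have hall : ∀ T : Module.End ℂ H, ∀ x ∈ W, T x ∈ W := by
    intro T
    have hT : T ∈ Algebra.adjoin ℂ {T | ∃ x a, T = E x a} := by
      rw [show Algebra.adjoin ℂ {T | ∃ x a, T = E x a} = ⊤ from hE]; trivial
    induction hT using Algebra.adjoin_induction with
    | mem T hT => obtain ⟨i, o, rfl⟩ := hT; exact hinv i o
    | algebraMap r =>
      intro x hx
      rw [Module.algebraMap_end_apply]
      exact W.smul_mem r hx
    | add T T' _ _ h h' => exact fun x hx => W.add_mem (h x hx) (h' x hx)
    | mul T T' _ _ h h' => exact fun x hx => h _ (h' x hx)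
  obtain ⟨w, hwW, hw⟩ := W.ne_bot_iff.mp hW
  rw [eq_top_iff]
  intro v _
  have hf : inner ℂ w w ≠ (0 : ℂ) := inner_self_ne_zero.mpr hw
  have h := hall ((innerₛₗ ℂ w).smulRight (((inner ℂ w w)⁻¹ : ℂ) • v)) w hwW
  rwa [LinearMap.smulRight_apply, innerₛₗ_apply_apply, smul_smul, mul_inv_cancel₀ hf,
    one_smul] at h

theorem finrank_range_add_finrank_range_one_sub [FiniteDimensional ℂ H] {P : Module.End ℂ H}
    (hP : P * P = P) :
    Module.finrank ℂ (LinearMap.range P) + Module.finrank ℂ (LinearMap.range (1 - P)) =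
      Module.finrank ℂ H := by
  have h : LinearMap.range (1 - P) = LinearMap.ker P :=
    (LinearMap.IsIdempotentElem.ker_eq_range (p := P) hP).symm
  rw [h, LinearMap.finrank_range_add_finrank_ker]

/-- Both ranks are even and add up to 4 or 6, so one is at most 2. The other outcome is its
complement, which has the same invariant subspaces. -/
theorem exists_measurement_projection_finrank_le_two [FiniteDimensional ℂ H]
    (J : H →ₛₗ[starRingEnd ℂ] H) (hJ : ∀ x, J (J x) = -x) {O : Type*} [Fintype O]
    (hO : Fintype.card O = 2) (hH : Module.finrank ℂ H = 4 ∨ Module.finrank ℂ H = 6)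
    (E : O → Module.End ℂ H) (hproj : ∀ a, E a * E a = E a) (hsum : ∑ a, E a = 1)
    (hEJ : ∀ a x, E a (J x) = J (E a x)) :
    ∃ a, Module.finrank ℂ (LinearMap.range (E a)) ≤ 2 ∧ ∀ a', E a' = E a ∨ E a' = 1 - E a := by
  classical
  obtain ⟨a, b, hab, huniv⟩ := Finset.card_eq_two.mp (Finset.card_univ.trans hO)
  rw [huniv, Finset.sum_pair hab] at hsum
  have hcases : ∀ o, o = a ∨ o = b := fun o => by
    have := Finset.mem_univ o
    rw [huniv] at this
    simpa using this
  have hb : E b = 1 - E a := eq_sub_of_add_eq' hsum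
  have ha : E a = 1 - E b := eq_sub_of_add_eq hsum
  have hsumr := finrank_range_add_finrank_range_one_sub (hproj a)
  rw [← hb] at hsumr
  obtain ⟨p, hp⟩ := even_finrank_range_of_commute_antilinear J hJ (hEJ a)
  obtain ⟨q, hq⟩ := even_finrank_range_of_commute_antilinear J hJ (hEJ b)
  rcases le_or_gt (Module.finrank ℂ (LinearMap.range (E a))) 2 with h | h
  · refine ⟨a, h, fun o => ?_⟩
    rcases hcases o with rfl | rfl
    · exact Or.inl rfl
    · exact Or.inr hb
  · refine ⟨b, by omega, fun o => ?_⟩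
    rcases hcases o with rfl | rfl
    · exact Or.inr ha
    · exact Or.inl rfl

/-- Small generating measurements do not commute with a quaternionic structure. -/
theorem SmallSide.not_quaternionic [FiniteDimensional ℂ H] {I O : Type*} [Fintype I] [Fintype O]
    {E : I → O → Module.End ℂ H} (hsmall : SmallSide E) (hE : GeneratesAllOperators E)
    (hsym : ∀ x a, (E x a).IsSymmetric) (hsum : ∀ x, ∑ a, E x a = 1)
    (J : H →ₛₗ[starRingEnd ℂ] H) (hJ : ∀ x, J (J x) = -x)
    (hEJ : ∀ i a x, E i a (J x) = J (E i a x)) : False := by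
  rcases hsmall with (h2 | hodd) | ⟨hdim, hI, hO, hproj⟩
  -- In dimension 2 the whole space is a quaternionic line: compressing to `P = 1` makes every
  -- operator a scalar, so every line is invariant.
  · have hid : Module.finrank ℂ (LinearMap.range (1 : Module.End ℂ H)) ≤ 2 := by
      rw [Module.End.one_eq_id, LinearMap.range_id, finrank_top, h2]
    have hscal : ∀ i a, ∃ r : ℝ, E i a = (r : ℂ) • (1 : Module.End ℂ H) := fun i a => by
      simpa using exists_compression_eq_smul J hJ (P := 1) (fun _ _ => rfl) (one_mul 1)
        (fun _ => rfl) hid (hsym i a) (hEJ i a)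
    have : Nontrivial H := Module.nontrivial_of_finrank_pos (R := ℂ) (by omega)
    obtain ⟨w, hw⟩ := exists_ne (0 : H)
    have htop := hE.eq_top_of_invariant (W := Submodule.span ℂ {w})
      (by simpa [Submodule.span_singleton_eq_bot] using hw) (by
        intro i a x hx
        obtain ⟨r, hr⟩ := hscal i a
        rw [hr]
        exact Submodule.smul_mem _ _ hx)
    have hone := finrank_span_singleton (K := ℂ) hw
    rw [htop, finrank_top] at hone
    omega
  · exact (Nat.not_even_iff_odd.mpr hodd) (even_finrank_of_antilinear_sq_eq_neg J hJ)
  · have : Nontrivial H := Module.nontrivial_of_finrank_pos (R := ℂ) (by omega)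
    choose a ha using fun i => exists_measurement_projection_finrank_le_two J hJ hO hdim (E i)
      (hproj i) (hsum i) (hEJ i)
    obtain ⟨f⟩ : Nonempty (I ↪ Fin 3) :=
      Function.Embedding.nonempty_of_card_le (by simpa using hI)
    -- With fewer than three inputs, the list of projections is padded with zeros.
    set P : Fin 3 → Module.End ℂ H := Function.extend f (fun i => E i (a i)) 0 with hPdef
    have hPf : ∀ i, P (f i) = E i (a i) := fun i => f.injective.extend_apply _ _ i
    have hP : ∀ k, (∃ i, P k = E i (a i)) ∨ P k = 0 := fun k => by
      by_cases hk : ∃ i, f i = k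
      · obtain ⟨i, rfl⟩ := hk
        exact Or.inl ⟨i, hPf i⟩
      · exact Or.inr (Function.extend_apply' _ _ _ hk)
    obtain ⟨W, hW, hW3, hinv⟩ := hasSmallInvariantSubspace_range J hJ P
      (fun k => by
        rcases hP k with ⟨i, h⟩ | h <;> rw [h]
        · exact ⟨hproj i _, hsym i _⟩
        · exact ⟨mul_zero 0, fun x y => by simp⟩)
      (fun k x => by
        rcases hP k with ⟨i, h⟩ | h <;> rw [h]
        · exact hEJ i _ x
        · simp)
      (fun k => by
        rcases hP k with ⟨i, h⟩ | h <;> rw [h]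
        · exact (ha i).1
        · rw [LinearMap.range_zero, finrank_bot]
          exact Nat.zero_le 2)
    have htop := hE.eq_top_of_invariant hW (by
      intro i o x hx
      have hx' : E i (a i) x ∈ W := by
        rw [← hPf]
        exact hinv _ ⟨f i, rfl⟩ x hx
      rcases (ha i).2 o with h | h <;> rw [h]
      · exact hx'
      · exact W.sub_mem hx hx')
    rw [htop, finrank_top] at hW3
    omega

end Antilinear

/-! ### Singular value decomposition. -/

section SingularValues

variable {𝕜 E F : Type*} [RCLike 𝕜] [NormedAddCommGroup E] [InnerProductSpace 𝕜 E]
  [FiniteDimensional 𝕜 E] [NormedAddCommGroup F] [InnerProductSpace 𝕜 F] [FiniteDimensional 𝕜 F]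

/-- Singular value decomposition of a linear map between finite-dimensional inner product
spaces. -/
theorem LinearMap.exists_singularValue_decomposition (T : E →ₗ[𝕜] F) {m n : ℕ}
    (hm : Module.finrank 𝕜 F = m) (hn : Module.finrank 𝕜 E = n) :
    ∃ (v : OrthonormalBasis (Fin n) 𝕜 E) (u : OrthonormalBasis (Fin m) 𝕜 F),
      ∀ i j, inner 𝕜 (u i) (T (v j)) =
        if (i : ℕ) = j then (T.singularValues j : 𝕜) else 0 := by
  set σ := T.singularValues with hσ
  set v := T.isSymmetric_adjoint_comp_self.eigenvectorBasis hn with hv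
  have hinner : ∀ i j, inner 𝕜 (T (v i)) (T (v j)) = if i = j then ((σ j : 𝕜)) ^ 2 else 0 := by
    intro i j
    have h1 : (LinearMap.adjoint T ∘ₗ T) (v j) = ((σ j : 𝕜)) ^ 2 • v j := by
      rw [hv, T.isSymmetric_adjoint_comp_self.apply_eigenvectorBasis hn j,
        ← T.sq_singularValues_fin hn j]
      simp [hσ]
    rw [← LinearMap.adjoint_inner_right, ← LinearMap.comp_apply, h1, inner_smul_right,
      orthonormal_iff_ite.mp v.orthonormal]
    simp
  have hzero : ∀ j : Fin n, σ j = 0 → T (v j) = 0 := by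
    intro j hj
    have := hinner j j
    simpa [hj] using this
  -- A nonzero `σ j` forces `j < rank T ≤ m`, so the index `j` is available in the target.
  have hpos : ∀ j : Fin n, σ j ≠ 0 → (j : ℕ) < m := by
    intro j hj
    have h1 := T.singularValues_pos_iff_lt_finrank_range.mp
      ((T.singularValues_pos_iff_ne_zero j).mpr hj)
    exact h1.trans_le ((Submodule.finrank_le _).trans hm.le)
  set s : Set (Fin m) := {i | σ i ≠ 0 ∧ (i : ℕ) < n} with hs
  -- Normalised images of the right singular vectors. They are orthonormal on `s`, where `σ i ≠ 0`,
  -- and are extended to a basis from there; the default `0` is never used.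
  set w : Fin m → F := fun i => if h : (i : ℕ) < n then ((σ i : 𝕜))⁻¹ • T (v ⟨i, h⟩) else 0 with hw
  have hworth : Orthonormal 𝕜 (s.domRestrict w) := by
    rw [orthonormal_iff_ite]
    rintro ⟨i, hi, hin⟩ ⟨j, hj, hjn⟩
    have hi' : (σ i : 𝕜) ≠ 0 := by exact_mod_cast hi
    have hj' : (σ j : 𝕜) ≠ 0 := by exact_mod_cast hj
    simp only [Set.domRestrict_apply, hw, hin, hjn, dif_pos, inner_smul_left, inner_smul_right,
      hinner, Subtype.mk.injEq, Fin.ext_iff]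
    split_ifs with h
    · rw [h]
      simp only [map_inv₀, RCLike.conj_ofReal]
      field_simp
    · simp
  obtain ⟨u, hu⟩ := Orthonormal.exists_orthonormalBasis_extension_of_card_eq (ι := Fin m)
    (by simpa using hm) hworth
  refine ⟨v, u, fun i j => ?_⟩
  by_cases hj : σ j = 0
  · simp [hzero j hj, hj]
  · have hj' : (σ j : 𝕜) ≠ 0 := by exact_mod_cast hj
    have huj : T (v j) = (σ j : 𝕜) • u ⟨j, hpos j hj⟩ := by
      rw [hu ⟨j, hpos j hj⟩ ⟨hj, j.2⟩]
      simp only [hw, j.2, dif_pos]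
      rw [smul_smul, mul_inv_cancel₀ hj', one_smul]
    rw [huj, inner_smul_right, orthonormal_iff_ite.mp u.orthonormal]
    simp [Fin.ext_iff]

/-- Singular value decomposition of a rectangular matrix. -/
theorem Matrix.exists_singularValue_decomposition {m n : ℕ} (M : Matrix (Fin m) (Fin n) 𝕜) :
    ∃ P ∈ Matrix.unitaryGroup (Fin m) 𝕜, ∃ Q ∈ Matrix.unitaryGroup (Fin n) 𝕜, ∃ σ : ℕ → ℝ,
      (∀ k, 0 ≤ σ k) ∧
      P.conjTranspose * M * Q = Matrix.of fun (i : Fin m) (j : Fin n) => if (i : ℕ) = j then (σ j : 𝕜) else 0 := by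
  obtain ⟨v, u, h⟩ := (Matrix.toEuclideanLin M).exists_singularValue_decomposition
    finrank_euclideanSpace_fin finrank_euclideanSpace_fin
  refine ⟨(EuclideanSpace.basisFun (Fin m) 𝕜).toBasis.toMatrix u,
    (EuclideanSpace.basisFun (Fin m) 𝕜).toMatrix_orthonormalBasis_mem_unitary u,
    (EuclideanSpace.basisFun (Fin n) 𝕜).toBasis.toMatrix v,
    (EuclideanSpace.basisFun (Fin n) 𝕜).toMatrix_orthonormalBasis_mem_unitary v,
    _, (Matrix.toEuclideanLin M).singularValues_nonneg, ?_⟩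
  ext i j
  rw [Matrix.of_apply, ← h]
  simp [Matrix.mul_apply, Module.Basis.toMatrix_apply, PiLp.inner_apply, Matrix.mulVec, dotProduct,
    Finset.sum_mul, Matrix.toEuclideanLin, Matrix.toLpLin_apply]
  rw [Finset.sum_comm]
  refine Finset.sum_congr rfl fun k _ => Finset.sum_congr rfl fun l _ => ?_
  ring

end SingularValues

/-! ### Antiunitary involutions and symmetric unitaries. -/

section RealStructure

/-- An antiunitary involution has an orthonormal basis of fixed vectors. -/
theorem exists_orthonormalBasis_fixed {H : Type*} [NormedAddCommGroup H] [InnerProductSpace ℂ H]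
    [FiniteDimensional ℂ H] (J : H →ₛₗ[starRingEnd ℂ] H) (hJ : ∀ x, J (J x) = x)
    (hinner : ∀ x y, inner ℂ (J x) (J y) = inner ℂ y x) {m : ℕ} (hm : Module.finrank ℂ H = m) :
    ∃ b : OrthonormalBasis (Fin m) ℂ H, ∀ i, J (b i) = b i := by
  let _ : InnerProductSpace ℝ H := InnerProductSpace.complexToReal
  -- The fixed vectors form a real form of `H`: a real orthonormal basis of `R` is a complex one of
  -- `H`.
  let R : Submodule ℝ H :=
    { carrier := {x | J x = x}
      add_mem' := fun {x y} hx hy => by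
        rw [Set.mem_ofPred_eq] at *
        rw [map_add, hx, hy]
      zero_mem' := map_zero J
      smul_mem' := fun c x hx => by
        rw [Set.mem_ofPred_eq] at *
        rw [← Complex.coe_smul, LinearMap.map_smulₛₗ, hx, Complex.conj_ofReal] }
  have hR : ∀ x, x ∈ R ↔ J x = x := fun x => Iff.rfl
  set b := stdOrthonormalBasis ℝ R with hb
  have hfix : ∀ i, J (b i : H) = b i := fun i => (b i).2
  have horth : Orthonormal ℂ (fun i => (b i : H)) := by
    rw [orthonormal_iff_ite]
    intro i j
    -- For fixed vectors `⟨x, y⟩ = ⟨J x, J y⟩ = ⟨y, x⟩`, so the inner product is real.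
    have h1 : inner ℂ (b i : H) (b j : H) = ((inner ℝ (b i) (b j) : ℝ) : ℂ) := by
      rw [Submodule.coe_inner, real_inner_eq_re_inner ℂ]
      refine (Complex.conj_eq_iff_re.mp ?_).symm
      rw [inner_conj_symm, ← hinner, hfix, hfix]
    rw [h1, orthonormal_iff_ite.mp b.orthonormal]
    split_ifs <;> simp
  have hRspan : ∀ x ∈ R, x ∈ Submodule.span ℂ (Set.range fun i => (b i : H)) := by
    intro x hx
    have h1 := congrArg Subtype.val (b.sum_repr ⟨x, hx⟩)
    simp only [Submodule.coe_sum, Submodule.coe_smul] at h1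
    rw [← h1]
    refine Submodule.sum_mem _ fun i _ => ?_
    rw [← Complex.coe_smul]
    exact Submodule.smul_mem _ _ (Submodule.subset_span ⟨i, rfl⟩)
  have hspan : ⊤ ≤ Submodule.span ℂ (Set.range fun i => (b i : H)) := by
    intro x _
    -- Both `x + J x` and `i (x - J x)` are fixed by `J`.
    have h1 : x = (1 / 2 : ℂ) • (x + J x) + (-Complex.I / 2) • (Complex.I • (x - J x)) := by
      rw [smul_smul, show -Complex.I / 2 * Complex.I = 1 / 2 by
        rw [div_mul_eq_mul_div, neg_mul, Complex.I_mul_I, neg_neg], ← smul_add,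
        add_add_sub_cancel, ← two_smul ℂ x, smul_smul]
      norm_num
    rw [h1]
    refine Submodule.add_mem _ (Submodule.smul_mem _ _ (hRspan _ ?_))
      (Submodule.smul_mem _ _ (hRspan _ ?_))
    · rw [hR, map_add, hJ, add_comm]
    · rw [hR, LinearMap.map_smulₛₗ, map_sub, hJ, Complex.conj_I, neg_smul, ← smul_neg, neg_sub]
  set B := OrthonormalBasis.mk horth hspan with hB
  have hcard : Module.finrank ℝ R = m := by
    rw [← hm, Module.finrank_eq_card_basis B.toBasis, Fintype.card_fin]
  refine ⟨B.reindex (finCongr hcard), fun i => ?_⟩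
  simp [hB, hfix]

/-- The antilinear map `x ↦ conj (U x)` on a Euclidean space. -/
def Matrix.conjMulVec {n : Type*} [Fintype n] (U : Matrix n n ℂ) :
    EuclideanSpace ℂ n →ₛₗ[starRingEnd ℂ] EuclideanSpace ℂ n where
  toFun x := WithLp.toLp 2 (star (U.mulVec x.ofLp))
  map_add' x y := by simp [Matrix.mulVec_add]
  map_smul' c x := by
    ext i
    simp [Matrix.mulVec_smul]

theorem Matrix.conjMulVec_conjMulVec {n : Type*} [Fintype n] (U : Matrix n n ℂ)
    (x : EuclideanSpace ℂ n) :
    U.conjMulVec (U.conjMulVec x) = WithLp.toLp 2 ((U.map star * U).mulVec x.ofLp) := by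
  ext i
  rw [← Matrix.mulVec_mulVec]
  simp [Matrix.conjMulVec, Matrix.mulVec, dotProduct]

/-- A Takagi-type statement: the antiunitary involution of a symmetric unitary matrix is entrywise
conjugation in suitable orthonormal coordinates. -/
theorem Matrix.exists_unitary_mul_eq_map_star {m : ℕ} {U : Matrix (Fin m) (Fin m) ℂ}
    (hU : U ∈ Matrix.unitaryGroup (Fin m) ℂ) (hsymm : U.transpose = U) :
    ∃ P ∈ Matrix.unitaryGroup (Fin m) ℂ, U * P = P.map star := by
  have hUU : U.map star * U = 1 := by
    have h1 : U.map star = star U := by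
      conv_rhs => rw [← hsymm]
      rfl
    rw [h1, Matrix.mem_unitaryGroup_iff'.mp hU]
  obtain ⟨b, hb⟩ := exists_orthonormalBasis_fixed U.conjMulVec
    (fun x => by rw [Matrix.conjMulVec_conjMulVec, hUU, Matrix.one_mulVec])
    (fun x y => by
      have h1 : dotProduct (star (U.mulVec y.ofLp)) (U.mulVec x.ofLp) =
          dotProduct (star y.ofLp) x.ofLp := by
        rw [Matrix.star_mulVec, Matrix.dotProduct_mulVec, Matrix.vecMul_vecMul,
          ← Matrix.star_eq_conjTranspose, Matrix.mem_unitaryGroup_iff'.mp hU, Matrix.vecMul_one]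
      rw [EuclideanSpace.inner_eq_star_dotProduct, EuclideanSpace.inner_eq_star_dotProduct,
        dotProduct_comm x.ofLp, ← h1]
      simp [Matrix.conjMulVec])
    (finrank_euclideanSpace_fin (𝕜 := ℂ) (n := m))
  -- The columns of `P` are the fixed vectors, for which `U b = b̄`.
  refine ⟨(EuclideanSpace.basisFun (Fin m) ℂ).toBasis.toMatrix b,
    (EuclideanSpace.basisFun (Fin m) ℂ).toMatrix_orthonormalBasis_mem_unitary b, ?_⟩
  ext i j
  have h := congrArg (fun x => star (x i)) (hb j)
  simpa [Matrix.conjMulVec, Matrix.mulVec, dotProduct, Matrix.mul_apply,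
    Module.Basis.toMatrix_apply] using h

end RealStructure

/-! ### Moments determine an irreducible strategy. -/

section Moments

/-- Words in a generating family span: a linear condition that holds on all words holds on the
generated algebra. -/
theorem Algebra.adjoin_range_induction_words {ι A : Type*} [Ring A] [Algebra ℂ A] {E : ι → A}
    {p : A → Prop} (hword : ∀ w : List ι, p (w.map E).prod)
    (hadd : ∀ a b, p a → p b → p (a + b)) (hsmul : ∀ (c : ℂ) a, p a → p (c • a))
    {a : A} (ha : a ∈ Algebra.adjoin ℂ (Set.range E)) : p a := by
  rw [← Subalgebra.mem_toSubmodule, Algebra.adjoin_eq_span] at ha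
  induction ha using Submodule.span_induction with
  | mem x hx =>
    obtain ⟨w, rfl⟩ : ∃ w : List ι, x = (w.map E).prod := by
      induction hx using Submonoid.closure_induction with
      | mem x hx => obtain ⟨i, rfl⟩ := hx; exact ⟨[i], by simp⟩
      | one => exact ⟨[], by simp⟩
      | mul x y _ _ hx hy =>
        obtain ⟨w, rfl⟩ := hx
        obtain ⟨w', rfl⟩ := hy
        exact ⟨w ++ w', by simp⟩
    exact hword w
  | zero => simpa using hsmul 0 _ (hword [])
  | add x y _ _ hx hy => exact hadd x y hx hy
  | smul c x _ hx => exact hsmul c x hx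

namespace Matrix

variable {m n : Type*} [Fintype m] [DecidableEq m] [Fintype n] [DecidableEq n]

theorem eq_zero_of_trace_mul_mul_eq_zero {ρ a : Matrix n n ℂ} (hρ : ρ ≠ 0)
    (h : ∀ b c : Matrix n n ℂ, trace (ρ * (b * a * c)) = 0) : a = 0 := by
  obtain ⟨i, j, hij⟩ : ∃ i j, ρ i j ≠ 0 := by
    by_contra! h0
    exact hρ (Matrix.ext h0)
  ext k l
  -- These matrix units reduce the trace to `ρ i j * a k l`.
  have h1 := h (single j k 1) (single l i 1)
  rw [← Matrix.mul_assoc, ← Matrix.mul_assoc, trace_mul_single] at h1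
  simpa [Matrix.mul_assoc, single_mul_apply_same, mul_apply, single_apply, hij, ite_and]
    using h1

/-- A `⋆`-automorphism of a matrix algebra is conjugation by a unitary. -/
theorem exists_unitary_of_starAlgEquiv (f : Matrix n n ℂ ≃⋆ₐ[ℂ] Matrix n n ℂ) :
    ∃ U ∈ unitaryGroup n ℂ, ∀ x, f x = U * x * Uᴴ := by
  set e : Matrix n n ℂ ≃⋆ₐ[ℂ] _ := toEuclideanCLM (n := n) (𝕜 := ℂ) with he
  set g := (e.symm.trans f).trans e with hg
  have hcont : Continuous g :=
    LinearMap.continuous_of_finiteDimensional (g.toAlgEquiv.toLinearMap)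
  obtain ⟨V, hV⟩ := StarAlgEquiv.eq_linearIsometryEquivConjStarAlgEquiv g hcont
  obtain ⟨u, rfl⟩ := Unitary.linearIsometryEquiv.surjective V
  rw [Unitary.conjStarAlgEquiv_unitaryLinearIsometryEquiv] at hV
  have hestar : ∀ x, e.symm (star x) = star (e.symm x) := e.symm.map_star'
  refine ⟨e.symm u, ?_, fun x => ?_⟩
  · rw [mem_unitaryGroup_iff, ← hestar, ← map_mul, Unitary.mul_star_self_of_mem u.2, map_one]
  · have h1 := congrArg (fun k => e.symm (k (e x))) hV
    simp only [hg, StarAlgEquiv.trans_apply, StarAlgEquiv.symm_apply_apply,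
      Unitary.conjStarAlgAut_apply, map_mul, hestar] at h1
    rw [h1, star_eq_conjTranspose]

/-- Two generating families of Hermitian matrices with the same moments are unitarily
equivalent. -/
theorem exists_unitary_of_trace_word_eq {ι : Type*} {E E' : ι → Matrix n n ℂ}
    (hE : ∀ i, (E i).IsHermitian) (hE' : ∀ i, (E' i).IsHermitian)
    (hgen : Algebra.adjoin ℂ (Set.range E) = ⊤) (hgen' : Algebra.adjoin ℂ (Set.range E') = ⊤)
    {ρ ρ' : Matrix n n ℂ} (hρ : ρ ≠ 0) (hρ' : ρ' ≠ 0)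
    (htr : ∀ w : List ι, trace (ρ * (w.map E).prod) = trace (ρ' * (w.map E').prod)) :
    ∃ U ∈ unitaryGroup n ℂ, ∀ i, U * E i * Uᴴ = E' i := by
  -- `A` will be the graph of an algebra automorphism sending `E i` to `E' i`: generation makes both
  -- projections onto, and equal moments make them injective.
  set A := Algebra.adjoin ℂ (Set.range fun i => (E i, E' i)) with hA
  have hmem : ∀ i, (E i, E' i) ∈ A := fun i => Algebra.subset_adjoin ⟨i, rfl⟩
  have htrA : ∀ a ∈ A, trace (ρ * a.1) = trace (ρ' * a.2) := by
    intro a ha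
    refine Algebra.adjoin_range_induction_words (p := fun a => trace (ρ * a.1) = trace (ρ' * a.2))
      (fun w => ?_) (fun a b ha hb => ?_) (fun c a ha => ?_) ha
    · have h := htr w
      rw [show (w.map E).prod = (w.map fun i => (E i, E' i)).prod.1 by
          rw [← RingHom.coe_fst, map_list_prod, List.map_map]; rfl,
        show (w.map E').prod = (w.map fun i => (E i, E' i)).prod.2 by
          rw [← RingHom.coe_snd, map_list_prod, List.map_map]; rfl] at h
      exact h
    · simp [Matrix.mul_add, ha, hb]
    · simp [ha]
  have hfst : ∀ x, ∃ y, (x, y) ∈ A := by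
    intro x
    have hx : x ∈ A.map (AlgHom.fst ℂ _ _) := by
      rw [hA, AlgHom.map_adjoin, ← Set.range_comp]
      change x ∈ Algebra.adjoin ℂ (Set.range E)
      rw [hgen]; trivial
    obtain ⟨⟨a, b⟩, h, rfl⟩ := hx
    exact ⟨b, h⟩
  have hsnd : ∀ y, ∃ x, (x, y) ∈ A := by
    intro x
    have hx : x ∈ A.map (AlgHom.snd ℂ _ _) := by
      rw [hA, AlgHom.map_adjoin, ← Set.range_comp]
      change x ∈ Algebra.adjoin ℂ (Set.range E')
      rw [hgen']; trivial
    obtain ⟨⟨a, b⟩, h, rfl⟩ := hx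
    exact ⟨a, h⟩
  have hinj : ∀ y, ((0 : Matrix n n ℂ), y) ∈ A → y = 0 := by
    intro y hy
    refine eq_zero_of_trace_mul_mul_eq_zero hρ' fun b c => ?_
    obtain ⟨b', hb⟩ := hsnd b
    obtain ⟨c', hc⟩ := hsnd c
    simpa using (htrA _ (mul_mem (mul_mem hb hy) hc)).symm
  have hinj' : ∀ x, (x, (0 : Matrix n n ℂ)) ∈ A → x = 0 := by
    intro x hx
    refine eq_zero_of_trace_mul_mul_eq_zero hρ fun b c => ?_
    obtain ⟨b', hb⟩ := hfst b
    obtain ⟨c', hc⟩ := hfst c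
    simpa using htrA _ (mul_mem (mul_mem hb hx) hc)
  set e₁ : A ≃ₐ[ℂ] Matrix n n ℂ := AlgEquiv.ofBijective ((AlgHom.fst ℂ _ _).comp A.val) (by
    refine ⟨(injective_iff_map_eq_zero _).mpr ?_, fun x => ?_⟩
    · rintro ⟨⟨a, b⟩, hab⟩ (rfl : a = 0)
      exact Subtype.ext (Prod.ext rfl (hinj b hab))
    · obtain ⟨y, hy⟩ := hfst x
      exact ⟨⟨_, hy⟩, rfl⟩) with he₁
  set e₂ : A ≃ₐ[ℂ] Matrix n n ℂ := AlgEquiv.ofBijective ((AlgHom.snd ℂ _ _).comp A.val) (by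
    refine ⟨(injective_iff_map_eq_zero _).mpr ?_, fun x => ?_⟩
    · rintro ⟨⟨a, b⟩, hab⟩ (rfl : b = 0)
      exact Subtype.ext (Prod.ext (hinj' a hab) rfl)
    · obtain ⟨y, hy⟩ := hsnd x
      exact ⟨⟨_, hy⟩, rfl⟩) with he₂
  set φ := e₁.symm.trans e₂ with hφ
  have hφE : ∀ i, φ (E i) = E' i := by
    intro i
    have h1 : e₁.symm (E i) = ⟨_, hmem i⟩ := by
      rw [AlgEquiv.symm_apply_eq]; rfl
    rw [hφ, AlgEquiv.trans_apply, h1]; rfl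
  -- The generators on both sides are Hermitian, so the automorphism respects the star.
  have hstar : ∀ x, φ (star x) = star (φ x) := by
    intro x
    have hx : x ∈ Algebra.adjoin ℂ (Set.range E) := by rw [hgen]; trivial
    induction hx using Algebra.adjoin_induction with
    | mem x hx =>
      obtain ⟨i, rfl⟩ := hx
      rw [hφE, star_eq_conjTranspose, star_eq_conjTranspose, (hE i).eq, (hE' i).eq, hφE]
    | algebraMap r =>
      rw [← algebraMap_star_comm, AlgEquiv.commutes, AlgEquiv.commutes, algebraMap_star_comm]
    | add x y _ _ hx hy => rw [star_add, map_add, map_add, star_add, hx, hy]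
    | mul x y _ _ hx hy => rw [star_mul, map_mul, map_mul, star_mul, hx, hy]
  obtain ⟨U, hU, h⟩ := exists_unitary_of_starAlgEquiv (StarAlgEquiv.ofAlgEquiv φ hstar)
  exact ⟨U, hU, fun i => by rw [← hφE]; exact (h (E i)).symm⟩

theorem trace_conjTranspose_mul_single_mul (M : Matrix m n ℂ)
    (i j : m) (k l : n) :
    trace (Mᴴ * single i j (1 : ℂ) * M * (single k l (1 : ℂ))ᵀ) = star (M i k) * M j l := by
  rw [transpose_single, trace_mul_single]
  simp [mul_apply, single_apply, ite_and]

/-- A bipartite vector is determined up to a phase by its expectation values. -/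
theorem exists_phase_of_trace_eq {M N : Matrix m n ℂ} (hM : M ≠ 0)
    (h : ∀ (X : Matrix m m ℂ) (Y : Matrix n n ℂ),
      trace (Mᴴ * X * M * Yᵀ) = trace (Nᴴ * X * N * Yᵀ)) :
    ∃ c : ℂ, star c * c = 1 ∧ N = c • M := by
  have h' : ∀ i j k l, star (M i k) * M j l = star (N i k) * N j l := fun i j k l => by
    rw [← trace_conjTranspose_mul_single_mul, h, trace_conjTranspose_mul_single_mul]
  obtain ⟨i, k, hik⟩ : ∃ i k, M i k ≠ 0 := by
    by_contra! h0
    exact hM (Matrix.ext h0)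
  have hN : N i k ≠ 0 := fun h0 => by
    have := h' i i k k
    simp [h0, hik] at this
  have hN' : star (N i k) ≠ 0 := star_ne_zero.mpr hN
  -- The phase solves `conj (M i k) * M j l = conj (N i k) * N j l` for `N j l`.
  refine ⟨star (M i k) / star (N i k), ?_, ?_⟩
  · rw [star_div₀, star_star, star_star, div_mul_div_comm, mul_comm (M i k), h' i i k k,
      mul_comm (N i k)]
    exact div_self (mul_ne_zero hN' hN)
  · ext j l
    rw [smul_apply, smul_eq_mul, div_mul_eq_mul_div, h', mul_div_cancel_left₀ _ hN']

theorem list_prod_conj {ι : Type*} {U : Matrix m m ℂ}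
    (hU : U ∈ unitaryGroup m ℂ) (E : ι → Matrix m m ℂ) (w : List ι) :
    (w.map fun i => U * E i * Uᴴ).prod = U * (w.map E).prod * Uᴴ := by
  have hUU : Uᴴ * U = 1 := mem_unitaryGroup_iff'.mp hU
  have hUU' : U * Uᴴ = 1 := mem_unitaryGroup_iff.mp hU
  induction w with
  | nil => simp [hUU']
  | cons i w ih =>
    rw [List.map_cons, List.prod_cons, ih, List.map_cons, List.prod_cons,
      show U * E i * Uᴴ * (U * (w.map E).prod * Uᴴ) =
        U * E i * (Uᴴ * U) * (w.map E).prod * Uᴴ by simp only [Matrix.mul_assoc], hUU]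
    simp only [Matrix.mul_assoc, Matrix.one_mul]

open scoped ComplexOrder in
/-- The moments determine an irreducible strategy up to local unitaries. -/
theorem exists_unitaries_of_moments_eq {ι κ : Type*} {E E' : ι → Matrix m m ℂ}
    {F F' : κ → Matrix n n ℂ} {M M' : Matrix m n ℂ}
    (hE : ∀ i, (E i).IsHermitian) (hE' : ∀ i, (E' i).IsHermitian)
    (hF : ∀ i, (F i).IsHermitian) (hF' : ∀ i, (F' i).IsHermitian)
    (hEgen : Algebra.adjoin ℂ (Set.range E) = ⊤) (hEgen' : Algebra.adjoin ℂ (Set.range E') = ⊤)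
    (hFgen : Algebra.adjoin ℂ (Set.range F) = ⊤) (hFgen' : Algebra.adjoin ℂ (Set.range F') = ⊤)
    (hM : M ≠ 0) (hM' : M' ≠ 0)
    (h : ∀ (w : List ι) (w' : List κ), trace (Mᴴ * (w.map E).prod * M * (w'.map F).prodᵀ) =
      trace (M'ᴴ * (w.map E').prod * M' * (w'.map F').prodᵀ)) :
    ∃ U ∈ unitaryGroup m ℂ, ∃ V ∈ unitaryGroup n ℂ, (∀ i, U * E i * Uᴴ = E' i) ∧
      (∀ i, V * F i * Vᴴ = F' i) ∧ U * M * Vᵀ = M' := by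
  -- Taking the empty word for the other party leaves the moments of the reduced state `M Mᴴ`; the
  -- second party has `Mᵀ Mᵀᴴ` instead.
  obtain ⟨U, hU, hUE⟩ := exists_unitary_of_trace_word_eq hE hE' hEgen hEgen'
    (ρ := M * Mᴴ) (ρ' := M' * M'ᴴ) (mt self_mul_conjTranspose_eq_zero.mp hM)
    (mt self_mul_conjTranspose_eq_zero.mp hM') (fun w => by
      have := h w []
      simp only [List.map_nil, List.prod_nil, transpose_one, Matrix.mul_one] at this
      rw [Matrix.mul_assoc, Matrix.mul_assoc, trace_mul_comm M, trace_mul_comm M', this])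
  obtain ⟨V, hV, hVF⟩ := exists_unitary_of_trace_word_eq hF hF' hFgen hFgen'
    (ρ := Mᵀ * Mᵀᴴ) (ρ' := M'ᵀ * M'ᵀᴴ) (mt self_mul_conjTranspose_eq_zero.mp (by simpa using hM))
    (mt self_mul_conjTranspose_eq_zero.mp (by simpa using hM')) (fun w => by
      have := h [] w
      simp only [List.map_nil, List.prod_nil, Matrix.mul_one] at this
      rw [← trace_transpose, transpose_mul, transpose_mul, transpose_transpose, trace_mul_comm,
        ← trace_transpose (M'ᵀ * M'ᵀᴴ * _), transpose_mul, transpose_mul, transpose_transpose,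
        trace_mul_comm _ (M'ᵀᴴᵀ * M')]
      exact this)
  have hUU' : U * Uᴴ = 1 := mem_unitaryGroup_iff.mp hU
  have hVV' : V * Vᴴ = 1 := mem_unitaryGroup_iff.mp hV
  have hVT : Vᴴᵀ * Vᵀ = 1 := by rw [← transpose_mul, hVV', transpose_one]
  -- `M'` is pulled back along `U` and `V`, so that `M` and `N` can be compared against the same
  -- operators.
  set N := Uᴴ * M' * Vᴴᵀ with hN
  have hM'N : U * N * Vᵀ = M' := by
    rw [hN, show U * (Uᴴ * M' * Vᴴᵀ) * Vᵀ = (U * Uᴴ) * M' * (Vᴴᵀ * Vᵀ) by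
      simp only [Matrix.mul_assoc], hUU', hVT, Matrix.one_mul, Matrix.mul_one]
  have hwE : ∀ w : List ι, (w.map E').prod = U * (w.map E).prod * Uᴴ := fun w => by
    rw [← list_prod_conj hU]
    simp only [hUE]
  have hwF : ∀ w : List κ, (w.map F').prod = V * (w.map F).prod * Vᴴ := fun w => by
    rw [← list_prod_conj hV]
    simp only [hVF]
  have hwords : ∀ (w : List ι) (w' : List κ),
      trace (Mᴴ * (w.map E).prod * M * (w'.map F).prodᵀ) =
        trace (Nᴴ * (w.map E).prod * N * (w'.map F).prodᵀ) := by
    intro w w'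
    rw [h, hwE, hwF, hN]
    simp only [transpose_mul, conjTranspose_mul, conjTranspose_conjTranspose]
    rw [show (Vᴴᵀ)ᴴ = Vᵀ by ext; simp,
      show Vᵀ * (M'ᴴ * U) * (w.map E).prod * (Uᴴ * M' * Vᴴᵀ) * (w'.map F).prodᵀ =
        Vᵀ * (M'ᴴ * U * (w.map E).prod * Uᴴ * M' * Vᴴᵀ * (w'.map F).prodᵀ) by
        simp only [Matrix.mul_assoc], trace_mul_comm Vᵀ]
    simp only [Matrix.mul_assoc]
  have hall : ∀ (X : Matrix m m ℂ) (Y : Matrix n n ℂ),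
      trace (Mᴴ * X * M * Yᵀ) = trace (Nᴴ * X * N * Yᵀ) := by
    intro X Y
    have hX : X ∈ Algebra.adjoin ℂ (Set.range E) := by rw [hEgen]; trivial
    have hY : Y ∈ Algebra.adjoin ℂ (Set.range F) := by rw [hFgen]; trivial
    refine Algebra.adjoin_range_induction_words
      (p := fun X => trace (Mᴴ * X * M * Yᵀ) = trace (Nᴴ * X * N * Yᵀ))
      (fun w => ?_) (fun a b ha hb => ?_) (fun c a ha => ?_) hX
    · refine Algebra.adjoin_range_induction_words (p := fun Y =>
        trace (Mᴴ * (w.map E).prod * M * Yᵀ) = trace (Nᴴ * (w.map E).prod * N * Yᵀ))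
        (hwords w) (fun a b ha hb => ?_) (fun c a ha => ?_) hY
      · simp only [transpose_add, Matrix.mul_add, trace_add, ha, hb]
      · simp only [transpose_smul, Matrix.mul_smul, trace_smul, ha]
    · simp only [Matrix.mul_add, Matrix.add_mul, trace_add, ha, hb]
    · simp only [Matrix.mul_smul, Matrix.smul_mul, trace_smul, ha]
  obtain ⟨c, hc, hNM⟩ := exists_phase_of_trace_eq hM hall
  have hc' : c * star c = 1 := by rw [mul_comm, hc]
  -- The phase is absorbed into `U`, where conjugation does not see it.
  refine ⟨c • U, ?_, V, hV, fun i => ?_, hVF, ?_⟩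
  · rw [mem_unitaryGroup_iff, star_smul, smul_mul_smul_comm, hc', one_smul]
    exact hUU'
  · rw [conjTranspose_smul, Matrix.smul_mul, Matrix.smul_mul, Matrix.mul_smul, smul_smul, hc',
      one_smul, hUE]
  · rw [← hM'N, hNM]
    simp only [Matrix.mul_smul, Matrix.smul_mul]

theorem map_star_mul {l k p : Type*} [Fintype p] (A : Matrix l p ℂ) (B : Matrix p k ℂ) :
    (A * B).map star = A.map star * B.map star := by
  ext; simp [mul_apply]

theorem map_star_map_star {l k : Type*} (A : Matrix l k ℂ) : (A.map star).map star = A := by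
  ext; simp

theorem trace_map_star {p : Type*} [Fintype p] (A : Matrix p p ℂ) : trace (A.map star) = star (trace A) := by
  simp [trace]

theorem list_prod_map_star {ι : Type*} (E : ι → Matrix n n ℂ) (w : List ι) :
    (w.map fun i => (E i).map star).prod = (w.map E).prod.map star := by
  induction w with
  | nil => ext i j; simp [one_apply, apply_ite]
  | cons i w ih => simp only [List.map_cons, List.prod_cons, ih, map_star_mul]

/-- Entrywise conjugation is only conjugate-linear, so generation is transported through words
instead of by an algebra homomorphism. -/
theorem adjoin_range_map_star_eq_top {ι : Type*} {E : ι → Matrix n n ℂ}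
    (hgen : Algebra.adjoin ℂ (Set.range E) = ⊤) :
    Algebra.adjoin ℂ (Set.range fun i => (E i).map star) = ⊤ := by
  rw [eq_top_iff]
  intro X _
  have hX : X.map star ∈ Algebra.adjoin ℂ (Set.range E) := by rw [hgen]; trivial
  rw [← map_star_map_star X]
  refine Algebra.adjoin_range_induction_words (p := fun X => X.map star ∈
    Algebra.adjoin ℂ (Set.range fun i => (E i).map star))
    (fun w => ?_) (fun a b ha hb => ?_) (fun c a ha => ?_) hX
  · rw [← list_prod_map_star]
    refine list_prod_mem fun x hx => ?_
    obtain ⟨i, _, rfl⟩ := List.mem_map.mp hx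
    exact Algebra.subset_adjoin ⟨i, rfl⟩
  · rw [Matrix.map_add _ star_add]; exact add_mem ha hb
  · rw [show (c • a).map star = star c • a.map star by ext; simp]
    exact Subalgebra.smul_mem _ ha _

/-- A unitary implementing complex conjugation on a generating family is symmetric or
antisymmetric. -/
theorem transpose_eq_or_eq_neg_of_generating {ι : Type*} {E : ι → Matrix n n ℂ}
    (hgen : Algebra.adjoin ℂ (Set.range E) = ⊤) {U : Matrix n n ℂ} (hU : U ∈ unitaryGroup n ℂ)
    (hUE : ∀ i, U * E i * Uᴴ = (E i).map star) : Uᵀ = U ∨ Uᵀ = -U := by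
  have hUU : Uᴴ * U = 1 := mem_unitaryGroup_iff'.mp hU
  have h1 : ∀ i, U * E i = (E i).map star * U := fun i => by
    rw [← hUE, Matrix.mul_assoc, hUU, Matrix.mul_one]
  have h2 : ∀ i, U.map star * (E i).map star = E i * U.map star := fun i => by
    rw [← map_star_mul, h1, map_star_mul, map_star_map_star]
  -- `Ū U` is central, hence a scalar `c`. Multiplying by `Uᵀ` gives `U = c Uᵀ`, and transposing
  -- gives `c² = 1` unless `U = 0`.
  have hcomm : ∀ X, Commute X (U.map star * U) := by
    intro X
    have hX : X ∈ Algebra.adjoin ℂ (Set.range E) := by rw [hgen]; trivial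
    induction hX using Algebra.adjoin_induction with
    | mem x hx =>
      obtain ⟨i, rfl⟩ := hx
      rw [Commute, SemiconjBy, ← Matrix.mul_assoc, ← h2, Matrix.mul_assoc, Matrix.mul_assoc, h1]
    | algebraMap r => exact Algebra.commutes r _
    | add x y _ _ hx hy => exact hx.add_left hy
    | mul x y _ _ hx hy => exact hx.mul_left hy
  obtain ⟨c, hc⟩ := mem_range_scalar_iff_commute_single'.mpr fun i j => hcomm (single i j 1)
  have hT : Uᵀ * U.map star = 1 := by
    rw [show U.map star = Uᴴᵀ by ext; simp, ← transpose_mul, hUU, transpose_one]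
  have h3 : U = c • Uᵀ := by
    have h4 : Uᵀ * (U.map star * U) = U := by rw [← Matrix.mul_assoc, hT, Matrix.one_mul]
    rw [← hc, scalar_apply, ← smul_one_eq_diagonal, Matrix.mul_smul, Matrix.mul_one] at h4
    exact h4.symm
  have h5 : Uᵀ = c • U := by
    conv_lhs => rw [h3, transpose_smul, transpose_transpose]
  have h6 : (1 - c * c) • U = 0 := by
    rw [sub_smul, one_smul, mul_smul, ← h5, ← h3, sub_self]
  rcases smul_eq_zero.mp h6 with h | h
  · rcases mul_self_eq_one_iff.mp (sub_eq_zero.mp h).symm with rfl | rfl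
    · exact Or.inl (by simpa using h5)
    · exact Or.inr (by simpa using h5)
  -- A unitary `U` vanishes only when `n` is empty.
  · exact Or.inl (by rw [h, transpose_zero])

end Matrix

end Moments

/-! ### Bipartite vectors as matrices and changes of basis. -/

section Coordinates

open Matrix

variable {HA HB : Type*} [NormedAddCommGroup HA] [InnerProductSpace ℂ HA]
  [NormedAddCommGroup HB] [InnerProductSpace ℂ HB] {m n : Type*} [Fintype m] [Fintype n]

/-- The coordinates of a bipartite vector, arranged in a matrix. -/
noncomputable def coordMatrix (u : OrthonormalBasis m ℂ HA) (v : OrthonormalBasis n ℂ HB)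
    (ψ : HA ⊗[ℂ] HB) : Matrix m n ℂ :=
  Matrix.of fun i j => (u.tensorProduct v).repr ψ (i, j)

theorem coordMatrix_apply (u : OrthonormalBasis m ℂ HA) (v : OrthonormalBasis n ℂ HB)
    (ψ : HA ⊗[ℂ] HB) (i : m) (j : n) :
    coordMatrix u v ψ i j = inner ℂ (u i ⊗ₜ[ℂ] v j) ψ := by
  rw [coordMatrix, Matrix.of_apply, OrthonormalBasis.repr_apply_apply,
    OrthonormalBasis.tensorProduct_apply]

theorem coordMatrix_add (u : OrthonormalBasis m ℂ HA) (v : OrthonormalBasis n ℂ HB)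
    (ψ φ : HA ⊗[ℂ] HB) : coordMatrix u v (ψ + φ) = coordMatrix u v ψ + coordMatrix u v φ := by
  ext i j
  simp [coordMatrix_apply, inner_add_right]

theorem inner_eq_trace_coordMatrix (u : OrthonormalBasis m ℂ HA) (v : OrthonormalBasis n ℂ HB)
    (φ ψ : HA ⊗[ℂ] HB) :
    inner ℂ φ ψ = trace ((coordMatrix u v φ)ᴴ * coordMatrix u v ψ) := by
  rw [← (u.tensorProduct v).repr.inner_map_map, EuclideanSpace.inner_eq_star_dotProduct]
  simp only [dotProduct, trace, diag_apply, mul_apply, conjTranspose_apply,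
    Fintype.sum_prod_type, coordMatrix, Matrix.of_apply, Pi.star_apply]
  rw [Finset.sum_comm]
  exact Finset.sum_congr rfl fun k _ => Finset.sum_congr rfl fun l _ => mul_comm _ _

theorem coordMatrix_ne_zero (u : OrthonormalBasis m ℂ HA) (v : OrthonormalBasis n ℂ HB)
    {ψ : HA ⊗[ℂ] HB} (hψ : ψ ≠ 0) : coordMatrix u v ψ ≠ 0 := by
  intro h
  have h1 := inner_eq_trace_coordMatrix u v ψ ψ
  rw [h, Matrix.mul_zero, trace_zero] at h1
  exact hψ (inner_self_eq_zero.mp h1)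

/-- Coordinates are conjugate-linear in the basis vectors, hence `Q̄` rather than `Q` on the right.
-/
theorem coordMatrix_rotate {u u' : OrthonormalBasis m ℂ HA} {v v' : OrthonormalBasis n ℂ HB}
    {P : Matrix m m ℂ} {Q : Matrix n n ℂ}
    (hu : ∀ k, u' k = ∑ i, P i k • u i) (hv : ∀ k, v' k = ∑ i, Q i k • v i) (ψ : HA ⊗[ℂ] HB) :
    coordMatrix u' v' ψ = Pᴴ * coordMatrix u v ψ * Q.map star := by
  ext k l
  simp only [coordMatrix_apply, hu, hv, mul_apply, TensorProduct.sum_tmul, TensorProduct.tmul_sum,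
    TensorProduct.smul_tmul_smul, sum_inner, conjTranspose_apply, map_apply, Finset.sum_mul]
  refine Finset.sum_congr rfl fun i _ => Finset.sum_congr rfl fun j _ => ?_
  refine (inner_smul_left (𝕜 := ℂ) (E := HA ⊗[ℂ] HB) _ _ _).trans ?_
  rw [map_mul, starRingEnd_apply, starRingEnd_apply]
  ring

variable [FiniteDimensional ℂ HA] [FiniteDimensional ℂ HB] [DecidableEq m] [DecidableEq n]

theorem coordMatrix_map (u : OrthonormalBasis m ℂ HA) (v : OrthonormalBasis n ℂ HB)
    (T : Module.End ℂ HA) (R : Module.End ℂ HB) (ψ : HA ⊗[ℂ] HB) :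
    coordMatrix u v (TensorProduct.map T R ψ) =
      LinearMap.toMatrixOrthonormal u T * coordMatrix u v ψ *
        (LinearMap.toMatrixOrthonormal v R)ᵀ := by
  induction ψ using TensorProduct.induction_on with
  | zero => ext i j; simp [coordMatrix, mul_apply]
  | add x y hx hy =>
    rw [map_add, coordMatrix_add, coordMatrix_add, hx, hy, Matrix.mul_add, Matrix.add_mul]
  | tmul x y =>
    have hT : ∀ i, inner ℂ (u i) (T x) =
        ∑ k, LinearMap.toMatrixOrthonormal u T i k * inner ℂ (u k) x := fun i => by
      conv_lhs => rw [← u.sum_repr x]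
      simp [map_sum, LinearMap.toMatrixOrthonormal_apply_apply,
        OrthonormalBasis.repr_apply_apply, mul_comm]
    have hR : ∀ i, inner ℂ (v i) (R y) =
        ∑ k, LinearMap.toMatrixOrthonormal v R i k * inner ℂ (v k) y := fun i => by
      conv_lhs => rw [← v.sum_repr y]
      simp [map_sum, LinearMap.toMatrixOrthonormal_apply_apply,
        OrthonormalBasis.repr_apply_apply, mul_comm]
    ext i j
    simp only [coordMatrix_apply, TensorProduct.map_tmul, TensorProduct.inner_tmul, mul_apply,
      transpose_apply, hT, hR, Finset.sum_mul, Finset.mul_sum]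
    refine Finset.sum_congr rfl fun k _ => Finset.sum_congr rfl fun l _ => ?_
    ring

/-- Rotating an orthonormal basis by a unitary matrix. -/
theorem OrthonormalBasis.exists_rotate (u : OrthonormalBasis m ℂ HA) {P : Matrix m m ℂ}
    (hP : P ∈ unitaryGroup m ℂ) :
    ∃ u' : OrthonormalBasis m ℂ HA, ∀ k, u' k = ∑ i, P i k • u i := by
  have horth : Orthonormal ℂ (fun k => ∑ i, P i k • u i) := by
    rw [orthonormal_iff_ite]
    intro k l
    have h1 := congrFun (congrFun (mem_unitaryGroup_iff'.mp hP) k) l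
    rw [u.orthonormal.inner_sum, ← one_apply (i := k), ← h1]
    simp [mul_apply]
  obtain ⟨b, hb⟩ := Orthonormal.exists_orthonormalBasis_extension_of_card_eq (𝕜 := ℂ) (E := HA)
    (ι := m) (v := fun k => ∑ i, P i k • u i) (s := Set.univ)
    (Module.finrank_eq_card_basis u.toBasis)
    (horth.comp _ Subtype.val_injective)
  exact ⟨b, fun k => hb k trivial⟩

theorem toMatrixOrthonormal_rotate {u u' : OrthonormalBasis m ℂ HA} {P : Matrix m m ℂ}
    (h : ∀ k, u' k = ∑ i, P i k • u i) (T : Module.End ℂ HA) :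
    LinearMap.toMatrixOrthonormal u' T = Pᴴ * LinearMap.toMatrixOrthonormal u T * P := by
  ext k l
  simp only [LinearMap.toMatrixOrthonormal_apply_apply, h, map_sum, map_smul, mul_apply,
    sum_inner, inner_sum, inner_smul_left, inner_smul_right, conjTranspose_apply,
    Finset.sum_mul, Finset.mul_sum]
  refine Finset.sum_congr rfl fun i _ => Finset.sum_congr rfl fun j _ => ?_
  simp only [starRingEnd_apply]
  ring

theorem isHermitian_toMatrixOrthonormal (u : OrthonormalBasis m ℂ HA) {T : Module.End ℂ HA}
    (hT : T.IsSymmetric) : (LinearMap.toMatrixOrthonormal u T).IsHermitian := by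
  ext i j
  rw [conjTranspose_apply, LinearMap.toMatrixOrthonormal_apply_apply,
    LinearMap.toMatrixOrthonormal_apply_apply, ← starRingEnd_apply, inner_conj_symm, hT]

theorem GeneratesAllOperators.adjoin_toMatrixOrthonormal {I O : Type*}
    {E : I → O → Module.End ℂ HA} (hE : GeneratesAllOperators E)
    (u : OrthonormalBasis m ℂ HA) :
    Algebra.adjoin ℂ (Set.range fun p : I × O => LinearMap.toMatrixOrthonormal u (E p.1 p.2)) =
      ⊤ := by
  set e : Module.End ℂ HA →ₐ[ℂ] Matrix m m ℂ :=
    (LinearMap.toMatrixOrthonormal u).toAlgEquiv.toAlgHom with he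
  have h1 : (Set.range fun p : I × O => LinearMap.toMatrixOrthonormal u (E p.1 p.2)) =
      e '' {T | ∃ x a, T = E x a} := by
    ext X
    constructor
    · rintro ⟨p, rfl⟩
      exact ⟨_, ⟨p.1, p.2, rfl⟩, rfl⟩
    · rintro ⟨_, ⟨x, a, rfl⟩, rfl⟩
      exact ⟨(x, a), rfl⟩
  rw [h1, ← AlgHom.map_adjoin,
    show Algebra.adjoin ℂ {T | ∃ x a, T = E x a} = ⊤ from hE, eq_top_iff]
  intro X _
  exact ⟨(LinearMap.toMatrixOrthonormal u).symm X, trivial,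
    (LinearMap.toMatrixOrthonormal u).apply_symm_apply X⟩

theorem toMatrixOrthonormal_measurementWord {I O : Type*} (E : I → O → Module.End ℂ HA)
    (u : OrthonormalBasis m ℂ HA) (w : List (I × O)) :
    LinearMap.toMatrixOrthonormal u (measurementWord E w) =
      (w.map fun p => LinearMap.toMatrixOrthonormal u (E p.1 p.2)).prod := by
  rw [measurementWord, map_list_prod, List.map_map]
  rfl

/-- The antiunitary map of `U` in the coordinates of `u`, when `U` is antisymmetric, is a
quaternionic structure; small irreducible measurements exclude it. -/
theorem SmallSide.transpose_eq {I O : Type*} [Fintype I] [Fintype O]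
    {E : I → O → Module.End ℂ HA} (hsmall : SmallSide E) (hE : GeneratesAllOperators E)
    (hsym : ∀ x a, (E x a).IsSymmetric) (hsum : ∀ x, ∑ a, E x a = 1)
    (u : OrthonormalBasis m ℂ HA) {U : Matrix m m ℂ} (hU : U ∈ unitaryGroup m ℂ)
    (hUE : ∀ x a, U * LinearMap.toMatrixOrthonormal u (E x a) * Uᴴ =
      (LinearMap.toMatrixOrthonormal u (E x a)).map star) : Uᵀ = U := by
  refine (transpose_eq_or_eq_neg_of_generating (hE.adjoin_toMatrixOrthonormal u) hU
    fun p => hUE p.1 p.2).resolve_right fun hneg => ?_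
  have hUU : Uᴴ * U = 1 := mem_unitaryGroup_iff'.mp hU
  have hbar : U.map star * U = -1 := by
    rw [show U.map star = Uᵀᴴ by ext; simp, hneg, conjTranspose_neg, Matrix.neg_mul, hUU]
  set J : HA →ₛₗ[starRingEnd ℂ] HA :=
    u.repr.symm.toLinearEquiv.toLinearMap.comp
      (U.conjMulVec.comp u.repr.toLinearEquiv.toLinearMap) with hJdef
  have hJx : ∀ x, J x = u.repr.symm (U.conjMulVec (u.repr x)) := fun _ => rfl
  have hrepr : ∀ (T : Module.End ℂ HA) x, u.repr (T x) =
      WithLp.toLp 2 ((LinearMap.toMatrixOrthonormal u T).mulVec (u.repr x).ofLp) := by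
    intro T x
    ext i
    have h := congrFun (LinearMap.toMatrix_mulVec_repr u.toBasis u.toBasis T x) i
    exact h.symm
  refine hsmall.not_quaternionic hE hsym hsum J (fun x => ?_) (fun x a y => ?_)
  · rw [hJx, hJx, u.repr.apply_symm_apply, conjMulVec_conjMulVec, hbar, Matrix.neg_mulVec,
      Matrix.one_mulVec, WithLp.toLp_neg, map_neg, WithLp.toLp_ofLp, u.repr.symm_apply_apply]
  · apply u.repr.injective
    rw [hrepr, hJx, hJx, u.repr.apply_symm_apply, u.repr.apply_symm_apply, hrepr]
    have h1 : U * LinearMap.toMatrixOrthonormal u (E x a) =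
        (LinearMap.toMatrixOrthonormal u (E x a)).map star * U := by
      rw [← hUE, Matrix.mul_assoc, hUU, Matrix.mul_one]
    simp only [conjMulVec, LinearMap.coe_mk, AddHom.coe_mk]
    rw [mulVec_mulVec, h1, ← mulVec_mulVec]
    generalize U.mulVec (u.repr y).ofLp = z
    congr 1
    ext i
    simp [mulVec, dotProduct]

end Coordinates

/-! ### The implications between the properties. -/

namespace BipartiteStrategy

open Matrix

variable {IA OA IB OB HA HB : Type*} [Fintype OA] [Fintype OB]
  [NormedAddCommGroup HA] [InnerProductSpace ℂ HA] [FiniteDimensional ℂ HA]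
  [NormedAddCommGroup HB] [InnerProductSpace ℂ HB] [FiniteDimensional ℂ HB]
  (S : BipartiteStrategy IA OA IB OB HA HB)

theorem state_ne_zero : S.state ≠ 0 := fun h => by
  have := S.norm_state
  simp [h] at this

theorem kronecker_mulVec_coord_iff (u : ONBasis HA) (v : ONBasis HB)
    (U : Matrix (Fin (Module.finrank ℂ HA)) (Fin (Module.finrank ℂ HA)) ℂ)
    (V : Matrix (Fin (Module.finrank ℂ HB)) (Fin (Module.finrank ℂ HB)) ℂ) :
    (U ⊗ₖ V).mulVec (S.coord u v) = star (S.coord u v) ↔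
      U * coordMatrix u v S.state * Vᵀ = (coordMatrix u v S.state).map star := by
  -- `vec` puts the column index first, hence the transpose.
  have h1 : S.coord u v = vec (coordMatrix u v S.state)ᵀ := rfl
  have h2 : star (vec (coordMatrix u v S.state)ᵀ) =
      vec ((coordMatrix u v S.state).map star)ᵀ := rfl
  rw [h1, kronecker_mulVec_vec, h2, vec_inj, ← transpose_inj, transpose_transpose]
  simp only [transpose_mul, transpose_transpose, Matrix.mul_assoc]

theorem inner_measurementWord (u : ONBasis HA) (v : ONBasis HB) (w : List (IA × OA))
    (w' : List (IB × OB)) :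
    inner ℂ S.state (TensorProduct.map (measurementWord S.E w) (measurementWord S.F w') S.state) =
      trace ((coordMatrix u v S.state)ᴴ * (w.map fun p => S.matE u p.1 p.2).prod *
        coordMatrix u v S.state * (w'.map fun p => S.matF v p.1 p.2).prodᵀ) := by
  rw [inner_eq_trace_coordMatrix u v, coordMatrix_map, toMatrixOrthonormal_measurementWord,
    toMatrixOrthonormal_measurementWord]
  simp only [Matrix.mul_assoc]
  rfl

theorem star_trace_word {m n ι κ : Type*} [Fintype m] [DecidableEq m] [Fintype n] [DecidableEq n]
    (E : ι → Matrix m m ℂ) (F : κ → Matrix n n ℂ) (M : Matrix m n ℂ) (w : List ι) (w' : List κ) :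
    star (trace (Mᴴ * (w.map E).prod * M * (w'.map F).prodᵀ)) =
      trace ((M.map star)ᴴ * (w.map fun i => (E i).map star).prod * M.map star *
        (w'.map fun i => (F i).map star).prodᵀ) := by
  rw [← trace_map_star, list_prod_map_star, list_prod_map_star, map_star_mul, map_star_mul,
    map_star_mul]
  rfl

/-- The conjugate strategy has the conjugate moments; when these are real the reconstruction theorem
applies, in any bases. -/
theorem IsMomentReal.isSelfConjugateAll {S : BipartiteStrategy IA OA IB OB HA HB}
    (h : S.IsMomentReal) (hS : S.IsIrreducible) : S.IsSelfConjugateAll := by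
  intro u v
  have hE : ∀ p : IA × OA, (S.matE u p.1 p.2).IsHermitian := fun p =>
    isHermitian_toMatrixOrthonormal u (S.E_pos _ _).isSymmetric
  have hF : ∀ p : IB × OB, (S.matF v p.1 p.2).IsHermitian := fun p =>
    isHermitian_toMatrixOrthonormal v (S.F_pos _ _).isSymmetric
  have hEgen := hS.1.adjoin_toMatrixOrthonormal u
  have hFgen := hS.2.adjoin_toMatrixOrthonormal v
  have hM := coordMatrix_ne_zero u v S.state_ne_zero
  obtain ⟨U, hU, V, hV, h1, h2, h3⟩ := exists_unitaries_of_moments_eq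
    (E := fun p : IA × OA => S.matE u p.1 p.2) (E' := fun p => (S.matE u p.1 p.2).map star)
    (F := fun p : IB × OB => S.matF v p.1 p.2) (F' := fun p => (S.matF v p.1 p.2).map star)
    (M := coordMatrix u v S.state) (M' := (coordMatrix u v S.state).map star)
    hE (fun p => (hE p).map star fun _ => rfl) hF (fun p => (hF p).map star fun _ => rfl)
    hEgen (adjoin_range_map_star_eq_top hEgen) hFgen (adjoin_range_map_star_eq_top hFgen)
    hM (fun h0 => hM (by rw [← map_star_map_star (coordMatrix u v S.state), h0]; ext; simp))
    (fun w w' => by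
      have hreal := Complex.conj_eq_iff_im.mpr (h w w')
      rw [S.inner_measurementWord u v] at hreal
      rw [← star_trace_word]
      exact hreal.symm)
  exact ⟨U, hU, V, hV, fun x a => h1 (x, a), fun y b => h2 (y, b),
    (S.kronecker_mulVec_coord_iff u v U V).mpr h3⟩

theorem IsSelfConjugate.isMomentReal {S : BipartiteStrategy IA OA IB OB HA HB}
    (h : S.IsSelfConjugate) : S.IsMomentReal := by
  obtain ⟨u, v, U, hU, V, hV, h1, h2, h3⟩ := h
  rw [kronecker_mulVec_coord_iff] at h3
  have hUU : Uᴴ * U = 1 := mem_unitaryGroup_iff'.mp hU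
  have hVV : Vᵀ * Vᴴᵀ = 1 := by
    rw [← transpose_mul, ← star_eq_conjTranspose, mem_unitaryGroup_iff'.mp hV, transpose_one]
  intro w w'
  rw [← Complex.conj_eq_iff_im, S.inner_measurementWord u v, starRingEnd_apply, star_trace_word]
  simp only [← h1, ← h2, ← h3, list_prod_conj hU, list_prod_conj hV]
  set M := coordMatrix u v S.state
  set A := (w.map fun p => S.matE u p.1 p.2).prod
  set B := (w'.map fun p => S.matF v p.1 p.2).prod
  rw [show (U * M * Vᵀ)ᴴ * (U * A * Uᴴ) * (U * M * Vᵀ) * (V * B * Vᴴ)ᵀ =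
      Vᴴᵀ * (Mᴴ * (Uᴴ * U) * A * (Uᴴ * U) * M * (Vᵀ * Vᴴᵀ) * Bᵀ * Vᵀ) by
    rw [conjTranspose_mul, conjTranspose_mul, transpose_mul, transpose_mul,
      show Vᵀᴴ = Vᴴᵀ from rfl]
    simp only [Matrix.mul_assoc], hUU, hVV, trace_mul_comm, Matrix.mul_assoc _ Vᵀ, hVV]
  simp only [Matrix.mul_one]

theorem isSchmidtBasis_of_coordMatrix {u : ONBasis HA} {v : ONBasis HB} {σ : ℕ → ℝ}
    (hσ : ∀ k, 0 ≤ σ k)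
    (h : ∀ i j, coordMatrix u v S.state i j = if (i : ℕ) = j then (σ j : ℂ) else 0) :
    S.IsSchmidtBasis u v := by
  refine ⟨fun k => σ k, fun k => hσ k, ?_⟩
  apply (u.tensorProduct v).repr.injective
  ext ⟨i, j⟩
  rw [OrthonormalBasis.repr_apply_apply, OrthonormalBasis.repr_apply_apply,
    OrthonormalBasis.tensorProduct_apply, ← coordMatrix_apply, h]
  simp only [inner_sum, inner_smul_right, TensorProduct.inner_tmul,
    orthonormal_iff_ite.mp u.orthonormal, orthonormal_iff_ite.mp v.orthonormal]
  split_ifs with hij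
  · have hk : (j : ℕ) < min (Module.finrank ℂ HA) (Module.finrank ℂ HB) :=
      lt_min (hij ▸ i.2) j.2
    rw [Finset.sum_eq_single ⟨j, hk⟩]
    · simp [Fin.ext_iff, hij]
    · intro k _ hkj
      have : ¬ (j : ℕ) = k := fun h0 => hkj (Fin.ext h0.symm)
      simp [Fin.ext_iff, this]
    · simp
  · rw [Finset.sum_eq_zero]
    intro k _
    by_cases hik : (i : ℕ) = k
    · have : ¬ (j : ℕ) = k := fun h0 => hij (hik.trans h0.symm)
      simp [Fin.ext_iff, this]
    · simp [Fin.ext_iff, hik]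

theorem exists_isSchmidtBasis : ∃ u v, S.IsSchmidtBasis u v := by
  set u := stdOrthonormalBasis ℂ HA
  set v := stdOrthonormalBasis ℂ HB
  obtain ⟨P, hP, Q, hQ, σ, hσ, h⟩ := (coordMatrix u v S.state).exists_singularValue_decomposition
  -- The second basis is rotated by `Q̄`, since `coordMatrix_rotate` conjugates it back to `Q`.
  have hQ' : Q.map star ∈ unitaryGroup _ ℂ := by
    rw [mem_unitaryGroup_iff, show star (Q.map star) = (star Q).map star from rfl, ← map_star_mul,
      mem_unitaryGroup_iff.mp hQ]
    ext i j
    simp [one_apply, apply_ite]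
  obtain ⟨u', hu⟩ := u.exists_rotate hP
  obtain ⟨v', hv⟩ := v.exists_rotate hQ'
  refine ⟨u', v', S.isSchmidtBasis_of_coordMatrix hσ fun i j => ?_⟩
  rw [coordMatrix_rotate hu hv, map_star_map_star, h]
  rfl

/-- Matrices with real entries are the entrywise images of real matrices. -/
theorem exists_map_ofReal_eq {m n : Type*} {M : Matrix m n ℂ} (h : ∀ i j, (M i j).im = 0) :
    ∃ N : Matrix m n ℝ, M = N.map Complex.ofReal :=
  ⟨M.map Complex.re, by ext i j; exact (Complex.ext rfl (by simpa using h i j))⟩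

theorem map_ofReal_mul {m n p : Type*} [Fintype n] (M : Matrix m n ℝ) (N : Matrix n p ℝ) :
    M.map Complex.ofReal * N.map Complex.ofReal = (M * N).map Complex.ofReal := by
  ext i j
  simp [mul_apply]

theorem map_ofReal_mem_unitaryGroup {m : Type*} [Fintype m] [DecidableEq m] {P : Matrix m m ℝ}
    (hP : P ∈ unitaryGroup m ℝ) : P.map Complex.ofReal ∈ unitaryGroup m ℂ := by
  rw [mem_unitaryGroup_iff,
    show star (P.map Complex.ofReal) = (star P).map Complex.ofReal by ext; simp, map_ofReal_mul,
    mem_unitaryGroup_iff.mp hP]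
  ext i j
  simp [one_apply, apply_ite]

theorem im_conjTranspose_mul_mul_ofReal {m n : Type*} [Fintype m] [Fintype n] {M : Matrix m n ℂ}
    (hM : ∀ i j, (M i j).im = 0) {p q : Type*} (P : Matrix m p ℝ) (Q : Matrix n q ℝ) (k : p)
    (l : q) : (((P.map Complex.ofReal)ᴴ * M * Q.map Complex.ofReal) k l).im = 0 := by
  obtain ⟨N, rfl⟩ := exists_map_ofReal_eq hM
  rw [show (P.map Complex.ofReal)ᴴ = Pᵀ.map Complex.ofReal by ext; simp, map_ofReal_mul,
    map_ofReal_mul]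
  simp

/-- The singular vectors of a real coordinate matrix can be chosen real, and rotating by real
orthogonal matrices keeps all operators real. -/
theorem IsReal.isSchmidtReal {S : BipartiteStrategy IA OA IB OB HA HB} (h : S.IsReal) :
    S.IsSchmidtReal := by
  obtain ⟨u, v, hE, hF, hψ⟩ := h
  obtain ⟨N, hN⟩ := exists_map_ofReal_eq (M := coordMatrix u v S.state) fun i j => hψ (i, j)
  obtain ⟨P, hP, Q, hQ, σ, hσ, h⟩ := N.exists_singularValue_decomposition
  obtain ⟨u', hu⟩ := u.exists_rotate (map_ofReal_mem_unitaryGroup hP)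
  obtain ⟨v', hv⟩ := v.exists_rotate (map_ofReal_mem_unitaryGroup hQ)
  have hQstar : (Q.map Complex.ofReal).map star = Q.map Complex.ofReal := by ext; simp
  have hcoord : coordMatrix u' v' S.state =
      (Pᴴ * N * Q).map Complex.ofReal := by
    rw [coordMatrix_rotate hu hv, hQstar, hN,
      show (P.map Complex.ofReal)ᴴ = Pᴴ.map Complex.ofReal by ext; simp, map_ofReal_mul,
      map_ofReal_mul]
  refine ⟨u', v', S.isSchmidtBasis_of_coordMatrix hσ fun i j => ?_, fun x a i j => ?_,
    fun y b i j => ?_, fun p => ?_⟩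
  · rw [hcoord, h, map_apply, of_apply]
    split_ifs <;> simp
  · rw [matE, toMatrixOrthonormal_rotate hu]
    exact im_conjTranspose_mul_mul_ofReal (hE x a) P P i j
  · rw [matF, toMatrixOrthonormal_rotate hv]
    exact im_conjTranspose_mul_mul_ofReal (hF y b) Q Q i j
  · change (coordMatrix u' v' S.state p.1 p.2).im = 0
    rw [hcoord]
    simp

theorem RealIn.selfConjugateIn {S : BipartiteStrategy IA OA IB OB HA HB} {u : ONBasis HA}
    {v : ONBasis HB} (h : S.RealIn u v) : S.SelfConjugateIn u v := by
  obtain ⟨hE, hF, hψ⟩ := h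
  refine ⟨1, one_mem _, 1, one_mem _, fun x a => ?_, fun y b => ?_, ?_⟩
  · ext i j
    simpa using (Complex.conj_eq_iff_im.mpr (hE x a i j)).symm
  · ext i j
    simpa using (Complex.conj_eq_iff_im.mpr (hF y b i j)).symm
  · ext p
    simpa using (Complex.conj_eq_iff_im.mpr (hψ p)).symm

theorem im_eq_zero_of_map_star_eq {m n : Type*} {M : Matrix m n ℂ} (h : M.map star = M) (i : m)
    (j : n) : (M i j).im = 0 :=
  Complex.conj_eq_iff_im.mp (congrFun (congrFun h i) j)

/-- The conjugate equals `(U P)ᴴ (U E Uᴴ) (U P)`, in which `U` cancels. -/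
theorem map_star_conj_eq {m : Type*} [Fintype m] [DecidableEq m] {U P E : Matrix m m ℂ}
    (hU : U ∈ unitaryGroup m ℂ) (hUP : U * P = P.map star) (hUE : U * E * Uᴴ = E.map star) :
    (Pᴴ * E * P).map star = Pᴴ * E * P := by
  have hUU : Uᴴ * U = 1 := mem_unitaryGroup_iff'.mp hU
  rw [map_star_mul, map_star_mul, show Pᴴ.map star = (P.map star)ᴴ from rfl, ← hUP, ← hUE,
    conjTranspose_mul, show Pᴴ * Uᴴ * (U * E * Uᴴ) * (U * P) =
      Pᴴ * (Uᴴ * U) * E * (Uᴴ * U) * P by simp only [Matrix.mul_assoc], hUU]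
  simp only [Matrix.mul_one]

theorem IsSelfConjugate.isReal [Fintype IA] [Fintype IB]
    {S : BipartiteStrategy IA OA IB OB HA HB} (h : S.IsSelfConjugate) (hS : S.IsIrreducible)
    (hA : SmallSide S.E) (hB : SmallSide S.F) : S.IsReal := by
  obtain ⟨u, v, U, hU, V, hV, h1, h2, h3⟩ := h
  rw [kronecker_mulVec_coord_iff] at h3
  have hUT : Uᵀ = U := hA.transpose_eq hS.1 (fun x a => (S.E_pos x a).isSymmetric) S.E_sum u hU h1
  have hVT : Vᵀ = V := hB.transpose_eq hS.2 (fun x a => (S.F_pos x a).isSymmetric) S.F_sum v hV h2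
  obtain ⟨P, hP, hUP⟩ := exists_unitary_mul_eq_map_star hU hUT
  obtain ⟨Q, hQ, hVQ⟩ := exists_unitary_mul_eq_map_star hV hVT
  obtain ⟨u', hu⟩ := u.exists_rotate hP
  obtain ⟨v', hv⟩ := v.exists_rotate hQ
  have hUU : Uᴴ * U = 1 := mem_unitaryGroup_iff'.mp hU
  refine ⟨u', v', fun x a => ?_, fun y b => ?_, fun p => ?_⟩
  · rw [matE, toMatrixOrthonormal_rotate hu]
    exact im_eq_zero_of_map_star_eq (map_star_conj_eq hU hUP (h1 x a))
  · rw [matF, toMatrixOrthonormal_rotate hv]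
    exact im_eq_zero_of_map_star_eq (map_star_conj_eq hV hVQ (h2 y b))
  · change (coordMatrix u' v' S.state p.1 p.2).im = 0
    refine im_eq_zero_of_map_star_eq ?_ _ _
    set M := coordMatrix u v S.state
    -- The conjugate of `Pᴴ M Q̄` is `(U P)ᴴ (U M Vᵀ) Q`; symmetry of `V` and `V Q = Q̄` turn it
    -- back into `Pᴴ M Q̄`.
    rw [coordMatrix_rotate hu hv, map_star_mul, map_star_mul, map_star_map_star,
      show Pᴴ.map star = (P.map star)ᴴ from rfl, ← hUP, ← h3, ← hVQ, hVT, conjTranspose_mul,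
      show Pᴴ * Uᴴ * (U * M * V) * Q = Pᴴ * (Uᴴ * U) * M * (V * Q) by
        simp only [Matrix.mul_assoc], hUU]
    simp only [Matrix.mul_one, M]

end BipartiteStrategy

theorem mainTheorem2 {IA OA IB OB HA HB : Type*}
    [Fintype IA] [Fintype OA] [Fintype IB] [Fintype OB]
    [NormedAddCommGroup HA] [InnerProductSpace ℂ HA] [FiniteDimensional ℂ HA]
    [NormedAddCommGroup HB] [InnerProductSpace ℂ HB] [FiniteDimensional ℂ HB]
    (S : BipartiteStrategy IA OA IB OB HA HB) (hS : S.IsIrreducible) :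
    (S.IsSchmidtReal ↔ S.IsReal) ∧
    (S.IsReal → S.IsSchmidtSelfConjugate) ∧
    List.TFAE [S.IsSchmidtSelfConjugate, S.IsSchmidtSelfConjugateAll,
      S.IsSelfConjugate, S.IsSelfConjugateAll, S.IsMomentReal] ∧
    (SmallSide S.E → SmallSide S.F →
      List.TFAE [S.IsSchmidtReal, S.IsReal,
        S.IsSchmidtSelfConjugate, S.IsSchmidtSelfConjugateAll,
        S.IsSelfConjugate, S.IsSelfConjugateAll, S.IsMomentReal]) := by
  have h12 : S.IsSchmidtReal → S.IsReal := fun ⟨u, v, _, h⟩ => ⟨u, v, h⟩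
  have h21 : S.IsReal → S.IsSchmidtReal := fun h => h.isSchmidtReal
  have h23 : S.IsReal → S.IsSchmidtSelfConjugate := fun h => by
    obtain ⟨u, v, hs, hr⟩ := h21 h
    exact ⟨u, v, hs, hr.selfConjugateIn⟩
  have h34 : S.IsSchmidtSelfConjugate → S.IsSelfConjugate := fun ⟨u, v, _, h⟩ => ⟨u, v, h⟩
  have h45 : S.IsSelfConjugate → S.IsMomentReal := fun h => h.isMomentReal
  have h54 : S.IsMomentReal → S.IsSelfConjugateAll := fun h => h.isSelfConjugateAll hS
  have h43 : S.IsSelfConjugateAll → S.IsSchmidtSelfConjugateAll := fun h u v _ => h u v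
  -- Without the existence of a Schmidt basis the universal statement could be vacuous.
  have h33 : S.IsSchmidtSelfConjugateAll → S.IsSchmidtSelfConjugate := fun h => by
    obtain ⟨u, v, hs⟩ := S.exists_isSchmidtBasis
    exact ⟨u, v, hs, h u v hs⟩
  refine ⟨⟨h12, h21⟩, h23, ?_, fun hA hB => ?_⟩
  · tfae_have 1 → 3 := h34
    tfae_have 3 → 5 := h45
    tfae_have 5 → 4 := h54
    tfae_have 4 → 2 := h43
    tfae_have 2 → 1 := h33
    tfae_finish
  · have h42 : S.IsSelfConjugate → S.IsReal := fun h => h.isReal hS hA hB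
    tfae_have 1 → 2 := h12
    tfae_have 2 → 1 := h21
    tfae_have 2 → 3 := h23
    tfae_have 3 → 5 := h34
    tfae_have 5 → 7 := h45
    tfae_have 7 → 6 := h54
    tfae_have 6 → 4 := h43
    tfae_have 4 → 3 := h33
    tfae_have 5 → 2 := h42
    tfae_finish
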